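/- **Setting.** There are $n\ge 1$ agents and rounds $t=1,2,\dots$. Let $\mathbb X\subseteq\mathbb R^p$ ($p\ge1$) be closed and convex, contain a ball of some radius $r>0$ centered at the origin, and be contained in the ball of radius $R$ centered at the origin. For every agent $i$ and round $t$, $f_{i,t}:\mathbb X\to\mathbb R$ is convex and $g_{i,t}:\mathbb X\to\mathbb R^{m_i}$ ($m_i\ge 1$) is componentwise convex, with $|f_{i,t}(x)-f_{i,t}(y)|\le F_1$ and $\|g_{i,t}(x)\|\le F_1$ for all $x,y\in\mathbb X$. At every $x\in\mathbb X$ there are a subgradient $\partial f_{i,t}(x)\in\mathbb R^p$ and a matrix $\partial g_{i,t}(x)\in\mathbb R^{p\times m_i}$ whose $k$-th column is a subgradient of the $k$-th component of $g_{i,t}$, with $\|\partial f_{i,t}(x)\|\le F_2$ and $\|\partial g_{i,t}(x)\|\le F_2$ (Euclidean norm and induced $2$-norm). Let $[\cdot]_+$ be the componentwise positive part, and let $\partial[g_{i,t}(x)]_+$ be $\partial g_{i,t}(x)$ with the $k$-th column replaced by $0$ whenever the $k$-th component of $g_{i,t}(x)$ is negative. Put $f_t=\frac1n\sum_{j}f_{j,t}$,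 $g_t=\mathrm{col}(g_{1,t},\dots,g_{n,t})$ and $m=\sum_i m_i$. Assume that for every $T\ge1$ some $x\in\mathbb X$ satisfies $g_t(x)\le 0$ for all $t=1,\dots,T$. The agents communicate over directed graphs $([n],\mathcal E_t)$ with mixing matrices $W_t\in\mathbb R^{n\times n}$ such that $[W_t]_{ij}>0$ if $(j,i)\in\mathcal E_t$ or $i=j$, and $[W_t]_{ij}=0$ otherwise. For constants $w\in(0,1)$ and an integer $B>0$ and for all $t\ge 1$: all positive entries of $W_t$ are at least $w$, $W_t$ is doubly stochastic, and $([n],\bigcup_{l=0}^{B-1}\mathcal E_{t+l})$ is strongly connected. **Algorithm.** Let $\kappa\in(0,1)$, $\alpha_t=\beta_t=t^{-\kappa}$ and $\gamma_t=t^{-(1-\kappa)}$. Start with arbitrary $x_{i,1}\in\mathbb X$ and $q_{i,1}=0$. For $t\ge1$ every agent $i$ computes $$z_{i,t+1}=\sum_{j=1}^n[W_t]_{ij}x_{j,t},\qquad \omega_{i,t+1}=\partial f_{i,t}(x_{i,t})+\partial[g_{i,t}(x_{i,t})]_+\,q_{i,t},\qquad x_{i,t+1}=\mathcal P_{\mathbb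 X}(z_{i,t+1}-\alpha_{t+1}\omega_{i,t+1}),$$ $$q_{i,t+1}=\Big[(1-\beta_{t+1}\gamma_{t+1})q_{i,t}+\gamma_{t+1}\big([g_{i,t}(x_{i,t})]_++(\partial[g_{i,t}(x_{i,t})]_+)^\top(x_{i,t+1}-x_{i,t})\big)\Big]_+,$$ where $\mathcal P_{\mathbb X}$ is the Euclidean projection onto $\mathbb X$. **Claim.** There are a constant $C_1$ that depends only on $n,\kappa,F_1,F_2,R,w,B$ and a constant $C_2$ that depends only on these and on $m$ such that, for every such problem, network and run of the algorithm and for every $T\ge1$: the function $\sum_{t=1}^Tf_t$ has a minimizer on $\{x\in\mathbb X: g_t(x)\le0,\ t=1,\dots,T\}$, and every such minimizer $\check x^*_T$ satisfies $$\frac1n\sum_{i=1}^n\sum_{t=1}^Tf_t(x_{i,t})-\sum_{t=1}^Tf_t(\check x_T^*)\le C_1\,T^{\max\{\kappa,1-\kappa\}};$$ moreover $$\frac1n\sum_{i=1}^n\sum_{t=1}^T\big\|[g_t(x_{i,t})]_+\big\|\le C_2\,T^{1-\kappa/2}.$$ -/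

import Mathlib

namespace DistOCO

open scoped Matrix

/-- `ℝᵖ` with the Euclidean norm. -/
abbrev Vec (p : ℕ) : Type := EuclideanSpace ℝ (Fin p)

/-- The componentwise positive part `[v]₊`, i.e. the projection onto the nonnegative orthant. -/
noncomputable def pos {ι : Type} (v : EuclideanSpace ℝ ι) : EuclideanSpace ℝ ι :=
  WithLp.toLp 2 (fun k => max (v k) 0)

/-- The concatenated vector `col(v₁, …, vₙ)`. -/
noncomputable def col {n : ℕ} {m : Fin n → ℕ} (v : (i : Fin n) → Vec (m i)) :
    EuclideanSpace ℝ ((i : Fin n) × Fin (m i)) :=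
  WithLp.toLp 2 (fun s => v s.1 s.2)

open scoped Matrix.Norms.L2Operator in
/-- The matrix norm induced by the Euclidean norms. -/
noncomputable def matNorm {p d : ℕ} (A : Matrix (Fin p) (Fin d) ℝ) : ℝ := ‖A‖

/-- `A v` as a Euclidean vector. -/
noncomputable def mulV {p d : ℕ} (A : Matrix (Fin p) (Fin d) ℝ) (v : Vec d) : Vec p :=
  WithLp.toLp 2 (A *ᵥ WithLp.ofLp v)

/-- The `k`-th column of `A` as a Euclidean vector. -/
noncomputable def colV {p d : ℕ} (A : Matrix (Fin p) (Fin d) ℝ) (k : Fin d) : Vec p :=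
  WithLp.toLp 2 (fun r => A r k)

/-- `s` is a subgradient at `x` of the function `f : X → ℝ`. -/
def IsSubgradient {p : ℕ} (X : Set (Vec p)) (f : Vec p → ℝ) (x s : Vec p) : Prop :=
  ∀ y ∈ X, f x + inner ℝ s (y - x) ≤ f y

/-- `y` is the Euclidean projection of `x` onto `K`, i.e. a minimizer of the distance to `x`
over `K` (unique when `K` is closed and convex). -/
def IsProjection {p : ℕ} (K : Set (Vec p)) (x y : Vec p) : Prop :=
  y ∈ K ∧ ∀ z ∈ K, ‖x - y‖ ≤ ‖x - z‖

/-- The data of a distributed online problem with `n` agents: the decision set, the local loss and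
constraint functions (agent `i`, round `t`; rounds are `t = 1, 2, …`, and only the values on the
decision set matter), and the (sub)gradients which are revealed to the agents: the vector
`subF i t x = ∂f_{i,t}(x)` and the matrix `subG i t x = ∂g_{i,t}(x)`, whose `k`-th column is the
(sub)gradient of the `k`-th component of `g_{i,t}`. -/
structure OnlineProblem (n p : ℕ) (m : Fin n → ℕ) where
  X : Set (Vec p)
  f : Fin n → ℕ → Vec p → ℝ
  g : (i : Fin n) → ℕ → Vec p → Vec (m i)
  subF : Fin n → ℕ → Vec p → Vec p
  subG : (i : Fin n) → ℕ → Vec p → Matrix (Fin p) (Fin (m i)) ℝ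

namespace OnlineProblem

variable {n p : ℕ} {m : Fin n → ℕ}

/-- The standing assumption on the decision set and on the loss and constraint functions,
with constants `F₁`, `F₂` and outer radius `R`. -/
structure Regular (P : OnlineProblem n p m) (F₁ F₂ R : ℝ) : Prop where
  convex_X : Convex ℝ P.X
  closed_X : IsClosed P.X
  inner_ball : ∃ r : ℝ, 0 < r ∧ Metric.closedBall 0 r ⊆ P.X
  outer_ball : P.X ⊆ Metric.closedBall 0 R
  convex_f : ∀ i, ∀ t ≥ 1, ConvexOn ℝ P.X (P.f i t)
  convex_g : ∀ i, ∀ t ≥ 1, ∀ k, ConvexOn ℝ P.X (fun x => P.g i t x k)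
  bound_f : ∀ i, ∀ t ≥ 1, ∀ x ∈ P.X, ∀ y ∈ P.X, |P.f i t x - P.f i t y| ≤ F₁
  bound_g : ∀ i, ∀ t ≥ 1, ∀ x ∈ P.X, ‖P.g i t x‖ ≤ F₁
  sub_f : ∀ i, ∀ t ≥ 1, ∀ x ∈ P.X, IsSubgradient P.X (P.f i t) x (P.subF i t x)
  sub_g : ∀ i, ∀ t ≥ 1, ∀ x ∈ P.X, ∀ k,
    IsSubgradient P.X (fun y => P.g i t y k) x (colV (P.subG i t x) k)
  bound_sub_f : ∀ i, ∀ t ≥ 1, ∀ x ∈ P.X, ‖P.subF i t x‖ ≤ F₂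
  bound_sub_g : ∀ i, ∀ t ≥ 1, ∀ x ∈ P.X, matNorm (P.subG i t x) ≤ F₂

/-- The global loss `f_t = (1/n) ∑ⱼ f_{j,t}`. -/
noncomputable def globalLoss (P : OnlineProblem n p m) (t : ℕ) (x : Vec p) : ℝ :=
  (1 / (n : ℝ)) * ∑ j, P.f j t x

/-- The global constraint function `g_t = col(g_{1,t}, …, g_{n,t})`. -/
noncomputable def globalConstraint (P : OnlineProblem n p m) (t : ℕ) (x : Vec p) :
    EuclideanSpace ℝ ((i : Fin n) × Fin (m i)) :=
  col (fun i => P.g i t x)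

/-- The (sub)gradient matrix `∂[g_{i,t}(x)]₊`: the `k`-th column is zero if the `k`-th component
of `g_{i,t}(x)` is negative, and the `k`-th column of `∂g_{i,t}(x)` otherwise. -/
noncomputable def subGPos (P : OnlineProblem n p m) (i : Fin n) (t : ℕ) (x : Vec p) :
    Matrix (Fin p) (Fin (m i)) ℝ :=
  Matrix.of (fun r k => if P.g i t x k < 0 then 0 else P.subG i t x r k)

/-- The decisions in `X` that satisfy `g_t ≤ 0` in all rounds `1, …, T`. -/
def staticFeasible (P : OnlineProblem n p m) (T : ℕ) : Set (Vec p) :=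
  {x | x ∈ P.X ∧ ∀ t ∈ Finset.Icc 1 T, ∀ s, P.globalConstraint t x s ≤ 0}

/-- `y` is an optimal static decision for the horizon `T`. -/
def IsStaticOptimum (P : OnlineProblem n p m) (T : ℕ) (y : Vec p) : Prop :=
  y ∈ P.staticFeasible T ∧
    IsMinOn (fun x => ∑ t ∈ Finset.Icc 1 T, P.globalLoss t x) (P.staticFeasible T) y

/-- Network regret of the decisions `x i t` against the comparator sequence `y`. -/
noncomputable def netReg (P : OnlineProblem n p m) (T : ℕ) (x : Fin n → ℕ → Vec p)
    (y : ℕ → Vec p) : ℝ :=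
  (1 / (n : ℝ)) * ∑ i, ∑ t ∈ Finset.Icc 1 T, P.globalLoss t (x i t)
    - ∑ t ∈ Finset.Icc 1 T, P.globalLoss t (y t)

/-- Network cumulative constraint violation. -/
noncomputable def netViolation (P : OnlineProblem n p m) (T : ℕ) (x : Fin n → ℕ → Vec p) : ℝ :=
  (1 / (n : ℝ)) * ∑ i, ∑ t ∈ Finset.Icc 1 T, ‖pos (P.globalConstraint t (x i t))‖

end OnlineProblem

/-- A time-varying directed graph on the agents with a mixing matrix in each round;
`edge t j i` means that `(j, i)` is an edge in round `t` (agent `i` hears agent `j`). -/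
structure Network (n : ℕ) where
  edge : ℕ → Fin n → Fin n → Prop
  W : ℕ → Matrix (Fin n) (Fin n) ℝ

/-- The mixing matrices are adapted to the graphs, and the standing assumption on the network holds
with weight bound `w` and connectivity period `B`. -/
structure Network.Regular {n : ℕ} (N : Network n) (w : ℝ) (B : ℕ) : Prop where
  weight_pos : ∀ t ≥ 1, ∀ i j, (N.edge t j i ∨ i = j) → 0 < N.W t i j
  weight_zero : ∀ t ≥ 1, ∀ i j, ¬ (N.edge t j i ∨ i = j) → N.W t i j = 0
  weight_ge : ∀ t ≥ 1, ∀ i j, 0 < N.W t i j → w ≤ N.W t i j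
  row_sum : ∀ t ≥ 1, ∀ i, ∑ j, N.W t i j = 1
  col_sum : ∀ t ≥ 1, ∀ j, ∑ i, N.W t i j = 1
  strongly_connected : ∀ t ≥ 1, ∀ a b,
    Relation.ReflTransGen (fun j i => ∃ l < B, N.edge (t + l) j i) a b

/-- `x` and `q` are the primal and dual iterates of the distributed online algorithm with
full-information feedback and parameter sequences `α`, `β`, `γ`, from some initial decisions:
with `z_{i,t+1} = ∑ⱼ [W_t]_{ij} x_{j,t}` and
`ω_{i,t+1} = ∂f_{i,t}(x_{i,t}) + ∂[g_{i,t}(x_{i,t})]₊ q_{i,t}`, the next decision `x_{i,t+1}` is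
the projection of `z_{i,t+1} - α_{t+1} ω_{i,t+1}` onto `X`. -/
structure IsRun {n p : ℕ} {m : Fin n → ℕ} (P : OnlineProblem n p m) (N : Network n)
    (α β γ : ℕ → ℝ) (x : Fin n → ℕ → Vec p) (q : (i : Fin n) → ℕ → Vec (m i)) : Prop where
  x_init : ∀ i, x i 1 ∈ P.X
  q_init : ∀ i, q i 1 = 0
  x_step : ∀ i, ∀ t ≥ 1,
    IsProjection P.X
      ((∑ j, N.W t i j • x j t)
        - α (t + 1) • (P.subF i t (x i t) + mulV (P.subGPos i t (x i t)) (q i t)))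
      (x i (t + 1))
  q_step : ∀ i, ∀ t ≥ 1,
    q i (t + 1) =
      pos ((1 - β (t + 1) * γ (t + 1)) • q i t
        + γ (t + 1) • (pos (P.g i t (x i t))
            + mulV (P.subGPos i t (x i t))ᵀ (x i (t + 1) - x i t)))

end DistOCO

/-! Fix a feasible comparator `y` and, for each agent, a nonnegative multiplier `μ i`. The primal
step gives an inequality for ‖x - y‖², the dual step one for ‖q - μ‖². When they are added, the
terms containing `q` cancel by convexity of the constraints, so no a priori bound on the dual
variables is needed (`IsRun.step_le`). The weighted distances telescope, up to the growth of the
primal weights, which costs T^κ.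

The remaining errors are the perturbations, i.e. the distances from x_{i,t+1} to the average
z_{i,t+1}, and the disagreement between agents. By consensus, the accumulated disagreement is at
most affine in the accumulated perturbation (`sum_disagreement_le`): products of nB mixing matrices
have all entries at least w^(nB), hence contract the diameter of the set of decisions. The
projection step leaves a spare negative term -‖perturbation‖²/(2α); by Young's inequality it pays
for any multiple Λ of the perturbation at the price αΛ²/2, which sums to order Λ² T^(1-κ). The
outcome is `energy_le`.

The regret bound takes μ = 0. The violation bound puts a multiplier of size s = T^(κ/2) on a single
constraint. The loss differences sum to at least -nF₁T, and all costs, including s² T^(1-κ), are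
O(T), so division by s leaves T^(1-κ/2). The same choice bounds the accumulated perturbation, and
hence the cost of evaluating a constraint at another agent's decision. -/

namespace DistOCO

open scoped Matrix RealInnerProductSpace

/-! ### Coordinatewise estimates and positive parts. -/

section Euclidean

variable {ι : Type} [Fintype ι]

theorem norm_le_norm_of_abs_le {u v : EuclideanSpace ℝ ι} (h : ∀ k, |u k| ≤ |v k|) :
    ‖u‖ ≤ ‖v‖ := by
  rw [EuclideanSpace.norm_eq, EuclideanSpace.norm_eq]
  apply Real.sqrt_le_sqrt
  apply Finset.sum_le_sum
  intro k _
  simpa only [Real.norm_eq_abs] using pow_le_pow_left₀ (abs_nonneg _) (h k) 2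

theorem norm_le_sum_abs (v : EuclideanSpace ℝ ι) : ‖v‖ ≤ ∑ k, |v k| := by
  rw [EuclideanSpace.norm_eq]
  apply Real.sqrt_le_iff.2
  refine ⟨Finset.sum_nonneg fun _ _ => abs_nonneg _, ?_⟩
  simpa only [Real.norm_eq_abs] using
    Finset.sum_sq_le_sq_sum_of_nonneg (s := Finset.univ) (f := fun k => |v k|)
      fun _ _ => abs_nonneg _

theorem inner_eq_sum_mul (u v : EuclideanSpace ℝ ι) : ⟪u, v⟫ = ∑ k, u k * v k := by
  rw [PiLp.inner_apply]
  exact Finset.sum_congr rfl fun k _ => by simp [mul_comm]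

omit [Fintype ι] in
theorem pos_apply (v : EuclideanSpace ℝ ι) (k : ι) : pos v k = max (v k) 0 := rfl

theorem norm_pos_le (v : EuclideanSpace ℝ ι) : ‖pos v‖ ≤ ‖v‖ :=
  norm_le_norm_of_abs_le fun k => by
    rw [pos_apply, abs_of_nonneg (le_max_right _ _)]
    exact max_le (le_abs_self _) (abs_nonneg _)

/-- The map r ↦ max r 0 is 1-Lipschitz and fixes every coordinate of `μ`. -/
theorem norm_pos_sub_le (u μ : EuclideanSpace ℝ ι) (hμ : ∀ k, 0 ≤ μ k) :
    ‖pos u - μ‖ ≤ ‖u - μ‖ :=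
  norm_le_norm_of_abs_le fun k => by
    have h := abs_max_sub_max_le_abs (u k) (μ k) 0
    rw [max_eq_left (hμ k)] at h
    simpa [pos_apply] using h

end Euclidean

/-! ### Matrices acting on Euclidean vectors. -/

section Matrix

variable {p d : ℕ}

theorem mulV_transpose_apply (A : Matrix (Fin p) (Fin d) ℝ) (u : Vec p) (k : Fin d) :
    mulV Aᵀ u k = ⟪colV A k, u⟫ := by
  rw [inner_eq_sum_mul]
  simp [mulV, colV, Matrix.mulVec, dotProduct]

theorem inner_mulV (A : Matrix (Fin p) (Fin d) ℝ) (v : Vec d) (u : Vec p) :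
    ⟪mulV A v, u⟫ = ⟪v, mulV Aᵀ u⟫ := by
  rw [inner_eq_sum_mul, inner_eq_sum_mul]
  simp only [mulV, Matrix.mulVec, dotProduct, Matrix.transpose_apply, Finset.sum_mul,
    Finset.mul_sum]
  rw [Finset.sum_comm]
  exact Finset.sum_congr rfl fun k _ => Finset.sum_congr rfl fun r _ => by ring

open scoped Matrix.Norms.L2Operator in
theorem norm_mulV_transpose_le (A : Matrix (Fin p) (Fin d) ℝ) (u : Vec p) :
    ‖mulV Aᵀ u‖ ≤ matNorm A * ‖u‖ := by
  have h := Matrix.l2_opNorm_mulVec Aᵀ u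
  rwa [← Matrix.conjTranspose_eq_transpose_of_trivial, Matrix.l2_opNorm_conjTranspose] at h

theorem abs_inner_colV_le (A : Matrix (Fin p) (Fin d) ℝ) (k : Fin d) (u : Vec p) :
    |⟪colV A k, u⟫| ≤ matNorm A * ‖u‖ := by
  rw [← mulV_transpose_apply]
  exact (PiLp.norm_apply_le (mulV Aᵀ u) k).trans (norm_mulV_transpose_le A u)

end Matrix

/-! ### Inequalities for a single primal or dual step. -/

theorem IsProjection.inner_le_zero {p : ℕ} {K : Set (Vec p)} (hK : Convex ℝ K) {u v : Vec p}
    (h : IsProjection K u v) {y : Vec p} (hy : y ∈ K) : ⟪u - v, y - v⟫ ≤ 0 := by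
  have : Nonempty K := ⟨⟨v, h.1⟩⟩
  refine (norm_eq_iInf_iff_real_inner_le_zero hK h.1).1 ?_ y hy
  apply le_antisymm
  · exact le_ciInf fun z => h.2 z z.2
  · exact ciInf_le ⟨0, by rintro _ ⟨z, rfl⟩; exact norm_nonneg _⟩ (⟨v, h.1⟩ : K)

/-- The proximal inequality for a projected step. -/
theorem IsProjection.two_mul_inner_le {p : ℕ} {K : Set (Vec p)} (hK : Convex ℝ K) {a : ℝ}
    {z ω v : Vec p} (h : IsProjection K (z - a • ω) v) {y : Vec p} (hy : y ∈ K) :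
    2 * a * ⟪ω, v - y⟫ ≤ ‖z - y‖ ^ 2 - ‖v - y‖ ^ 2 - ‖v - z‖ ^ 2 := by
  have h1 := h.inner_le_zero hK hy
  have e1 : z - a • ω - v = -(v - z) - a • ω := by abel
  have e2 : z - y = (v - y) - (v - z) := by abel
  have e3 : y - v = -(v - y) := by abel
  rw [e1, e3, inner_neg_right, inner_sub_left, inner_neg_left, real_inner_smul_left] at h1
  rw [e2, norm_sub_sq_real, real_inner_comm (v - z) (v - y)]
  linarith

/-- The drift inequality for a regularized dual step. -/
theorem dual_drift {ι : Type} [Fintype ι] {b c : ℝ} (hb : 0 ≤ b) (hc : 0 ≤ c)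
    (hbc : b * c ≤ 1 / 2) (q v μ : EuclideanSpace ℝ ι) (hμ : ∀ k, 0 ≤ μ k) :
    ‖pos ((1 - b * c) • q + c • v) - μ‖ ^ 2 - (1 - b * c) * ‖q - μ‖ ^ 2 + 2 * c * ⟪μ, v⟫
      - b * c * ‖μ‖ ^ 2 - 2 * c ^ 2 * ‖v‖ ^ 2 ≤ 2 * c * ⟪q, v⟫ := by
  have h1 : ‖pos ((1 - b * c) • q + c • v) - μ‖ ^ 2 ≤ ‖(1 - b * c) • q + c • v - μ‖ ^ 2 := by
    gcongr
    exact norm_pos_sub_le _ _ hμ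
  have e1 : (1 - b * c) • q + c • v - μ = (q - μ) + c • (v - b • q) := by
    module
  rw [e1, norm_add_sq_real] at h1
  have h2 : ‖v - b • q‖ ^ 2 ≤ 2 * ‖v‖ ^ 2 + 2 * (b ^ 2 * ‖q‖ ^ 2) := by
    have := parallelogram_law_with_norm ℝ v (b • q)
    have h3 : ‖b • q‖ = b * ‖q‖ := by rw [norm_smul, Real.norm_of_nonneg hb]
    rw [h3] at this
    nlinarith [sq_nonneg ‖v + b • q‖]
  have h4 : ‖c • (v - b • q)‖ ^ 2 = c ^ 2 * ‖v - b • q‖ ^ 2 := by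
    rw [norm_smul, Real.norm_of_nonneg hc, mul_pow]
  -- The condition bc ≤ 1/2 keeps the second-order term in `q` below bc‖q‖², half of what the
  -- regularization gains.
  have h5 : c ^ 2 * ‖v - b • q‖ ^ 2 ≤ 2 * c ^ 2 * ‖v‖ ^ 2 + b * c * ‖q‖ ^ 2 := by
    have h6 := mul_le_mul_of_nonneg_left h2 (sq_nonneg c)
    have h7 : 2 * (b * c) * (b * c) * ‖q‖ ^ 2 ≤ 1 * (b * c) * ‖q‖ ^ 2 := by
      gcongr
      linarith
    nlinarith
  have e2 : ⟪q - μ, c • (v - b • q)⟫ = c * (⟪q, v⟫ - ⟪μ, v⟫) - b * c * (‖q‖ ^ 2 - ⟪q, μ⟫) := by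
    rw [real_inner_smul_right, inner_sub_right, inner_sub_left, real_inner_smul_right,
      inner_sub_left, real_inner_self_eq_norm_sq, real_inner_comm μ q]
    ring
  have e3 := norm_sub_sq_real q μ
  rw [h4, e2] at h1
  have h8 : b * c * ‖q - μ‖ ^ 2 = b * c * (‖q‖ ^ 2 - 2 * ⟪q, μ⟫ + ‖μ‖ ^ 2) := by rw [e3]
  linarith

/-- The subgradient inequalities at `x` and at `y` bound the difference from both sides. The
hypothesis on inner products covers gradients and columns of a Jacobian alike. -/
theorem IsSubgradient.abs_sub_le {p : ℕ} {X : Set (Vec p)} {f : Vec p → ℝ} {s : Vec p → Vec p}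
    {C : ℝ} (hs : ∀ x ∈ X, IsSubgradient X f x (s x))
    (hC : ∀ x ∈ X, ∀ u, |⟪s x, u⟫| ≤ C * ‖u‖) {x y : Vec p} (hx : x ∈ X) (hy : y ∈ X) :
    |f x - f y| ≤ C * ‖x - y‖ := by
  have h1 := hs x hx y hy
  have h2 := hs y hy x hx
  have h3 := (abs_le.1 (hC x hx (y - x))).1
  have h4 := (abs_le.1 (hC y hy (x - y))).1
  rw [norm_sub_rev] at h3
  rw [abs_le]
  constructor <;> linarith

/-! ### Lipschitz bounds and existence of the static optimum. -/

namespace OnlineProblem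

variable {n p : ℕ} {m : Fin n → ℕ} {P : OnlineProblem n p m} {F₁ F₂ R : ℝ}

theorem mulV_subGPos_transpose_apply (i : Fin n) (t : ℕ) (x u : Vec p) (k : Fin (m i)) :
    mulV (P.subGPos i t x)ᵀ u k =
      if P.g i t x k < 0 then 0 else ⟪colV (P.subG i t x) k, u⟫ := by
  rw [mulV_transpose_apply]
  split_ifs with h
  · rw [inner_eq_sum_mul]
    exact Finset.sum_eq_zero fun r _ => by simp [colV, subGPos, h]
  · congr 1
    ext r
    simp [colV, subGPos, h]

namespace Regular

variable (hP : P.Regular F₁ F₂ R)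
include hP

theorem zero_mem : (0 : Vec p) ∈ P.X := by
  obtain ⟨r, hr, h⟩ := hP.inner_ball
  exact h (Metric.mem_closedBall_self hr.le)

theorem R_nonneg : 0 ≤ R := by
  simpa using hP.outer_ball hP.zero_mem

theorem F₁_nonneg (i : Fin n) : 0 ≤ F₁ :=
  (abs_nonneg _).trans (hP.bound_f i 1 le_rfl 0 hP.zero_mem 0 hP.zero_mem)

theorem F₂_nonneg (i : Fin n) : 0 ≤ F₂ :=
  (norm_nonneg _).trans (hP.bound_sub_f i 1 le_rfl 0 hP.zero_mem)

theorem norm_sub_le {x y : Vec p} (hx : x ∈ P.X) (hy : y ∈ P.X) : ‖x - y‖ ≤ 2 * R := by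
  have h1 := hP.outer_ball hx
  have h2 := hP.outer_ball hy
  rw [mem_closedBall_zero_iff] at h1 h2
  linarith [_root_.norm_sub_le x y]

theorem abs_f_sub_le (i : Fin n) {t : ℕ} (ht : 1 ≤ t) {x y : Vec p} (hx : x ∈ P.X)
    (hy : y ∈ P.X) : |P.f i t x - P.f i t y| ≤ F₂ * ‖x - y‖ :=
  IsSubgradient.abs_sub_le (hP.sub_f i t ht)
    (fun x hx u => (abs_real_inner_le_norm _ _).trans
      (mul_le_mul_of_nonneg_right (hP.bound_sub_f i t ht x hx) (norm_nonneg u))) hx hy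

theorem abs_g_sub_le (i : Fin n) {t : ℕ} (ht : 1 ≤ t) (k : Fin (m i)) {x y : Vec p}
    (hx : x ∈ P.X) (hy : y ∈ P.X) : |P.g i t x k - P.g i t y k| ≤ F₂ * ‖x - y‖ :=
  IsSubgradient.abs_sub_le (f := fun y => P.g i t y k) (fun x hx => hP.sub_g i t ht x hx k)
    (fun x hx u => (abs_inner_colV_le _ k u).trans
      (mul_le_mul_of_nonneg_right (hP.bound_sub_g i t ht x hx) (norm_nonneg u))) hx hy

/-- Zeroing columns of the matrix only zeroes coordinates of the transposed product. -/
theorem norm_mulV_subGPos_transpose_le (i : Fin n) {t : ℕ} (ht : 1 ≤ t) {x : Vec p}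
    (hx : x ∈ P.X) (u : Vec p) : ‖mulV (P.subGPos i t x)ᵀ u‖ ≤ F₂ * ‖u‖ := by
  refine le_trans (norm_le_norm_of_abs_le (v := mulV (P.subG i t x)ᵀ u) fun k => ?_)
    ((norm_mulV_transpose_le _ u).trans
      (mul_le_mul_of_nonneg_right (hP.bound_sub_g i t ht x hx) (norm_nonneg u)))
  rw [mulV_subGPos_transpose_apply, mulV_transpose_apply]
  split_ifs with h
  · simp
  · exact le_rfl

/-- The static optimum exists as soon as the feasible set is nonempty. -/
theorem exists_isStaticOptimum {T : ℕ} (hT : (P.staticFeasible T).Nonempty) :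
    ∃ y, P.IsStaticOptimum T y := by
  -- Convexity alone would not give continuity at the boundary of `P.X`; bounded subgradients do.
  have hlip : ∀ h : Vec p → ℝ, (∀ x ∈ P.X, ∀ y ∈ P.X, |h x - h y| ≤ F₂ * ‖x - y‖) →
      ContinuousOn h P.X := fun h hh =>
    (LipschitzOnWith.of_dist_le_mul (K := F₂.toNNReal) fun x hx y hy => by
      rw [Real.dist_eq, dist_eq_norm]
      exact (hh x hx y hy).trans
        (mul_le_mul_of_nonneg_right (Real.le_coe_toNNReal F₂) (norm_nonneg _))).continuousOn
  have hX : IsCompact P.X :=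
    (isCompact_closedBall (0 : Vec p) R).of_isClosed_subset hP.closed_X hP.outer_ball
  have hcl : IsClosed (P.staticFeasible T) := by
    have : P.staticFeasible T = P.X ∩ ⋂ t ∈ Finset.Icc 1 T,
        ⋂ s : (i : Fin n) × Fin (m i), P.X ∩ (fun x => P.g s.1 t x s.2) ⁻¹' Set.Iic 0 := by
      ext x
      simp only [staticFeasible, globalConstraint, col, Set.mem_ofPred_eq, Set.mem_inter_iff,
        Set.mem_iInter, Set.mem_preimage, Set.mem_Iic]
      exact ⟨fun h => ⟨h.1, fun t ht s => ⟨h.1, h.2 t ht s⟩⟩,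
        fun h => ⟨h.1, fun t ht s => (h.2 t ht s).2⟩⟩
    rw [this]
    refine hP.closed_X.inter (isClosed_biInter fun t ht => isClosed_iInter fun s => ?_)
    exact (hlip _ fun x hx y hy => hP.abs_g_sub_le s.1 (Finset.mem_Icc.1 ht).1 s.2 hx hy)
      |>.preimage_isClosed_of_isClosed hP.closed_X isClosed_Iic
  have hsub : P.staticFeasible T ⊆ P.X := fun x hx => hx.1
  have hcont : ContinuousOn (fun x => ∑ t ∈ Finset.Icc 1 T, P.globalLoss t x)
      (P.staticFeasible T) := by
    refine ContinuousOn.mono (continuousOn_finsetSum _ fun t ht => ?_) hsub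
    exact continuousOn_const.mul (continuousOn_finsetSum _ fun j _ =>
      hlip _ fun x hx y hy => hP.abs_f_sub_le j (Finset.mem_Icc.1 ht).1 hx hy)
  obtain ⟨y, hy, hmin⟩ := (hX.of_isClosed_subset hcl hsub).exists_isMinOn hT hcont
  exact ⟨y, hy, hmin⟩

end Regular

end OnlineProblem

/-- The averaged decision `z_{i,t+1}`. -/
noncomputable def mixed {n p : ℕ} (N : Network n) (x : Fin n → ℕ → Vec p) (i : Fin n) (t : ℕ) :
    Vec p :=
  ∑ j, N.W t i j • x j t

/-! ### One round of the primal-dual iteration. -/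

namespace IsRun

variable {n p : ℕ} {m : Fin n → ℕ} {P : OnlineProblem n p m} {N : Network n} {α β γ : ℕ → ℝ}
  {x : Fin n → ℕ → Vec p} {q : (i : Fin n) → ℕ → Vec (m i)} {F₁ F₂ R : ℝ}

theorem mem (h : IsRun P N α β γ x q) (i : Fin n) {t : ℕ} (ht : 1 ≤ t) : x i t ∈ P.X := by
  obtain rfl | ht' := ht.eq_or_lt
  · exact h.x_init i
  · obtain ⟨s, rfl⟩ := Nat.exists_eq_add_of_le' ht
    exact (h.x_step i s (by omega)).1

theorem q_nonneg (h : IsRun P N α β γ x q) (i : Fin n) {t : ℕ} (ht : 1 ≤ t) (k : Fin (m i)) :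
    0 ≤ q i t k := by
  obtain rfl | ht' := ht.eq_or_lt
  · simp [h.q_init i]
  · obtain ⟨s, rfl⟩ := Nat.exists_eq_add_of_le' ht
    rw [h.q_step i s (by omega)]
    exact le_max_right _ _

/-- The basic one-step inequality for the primal-dual iteration of one agent. -/
theorem step_le (h : IsRun P N α β γ x q) (hP : P.Regular F₁ F₂ R) (i : Fin n) {t : ℕ}
    (ht : 1 ≤ t) (hα : 0 < α (t + 1)) (hβ : 0 ≤ β (t + 1)) (hγ : 0 < γ (t + 1))
    (hβγ : β (t + 1) * γ (t + 1) ≤ 1 / 2) {y : Vec p} (hy : y ∈ P.X)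
    (hgy : ∀ k, P.g i t y k ≤ 0) (μ : Vec (m i)) (hμ : ∀ k, 0 ≤ μ k) :
    P.f i t (x i t) - P.f i t y + ⟪μ, pos (P.g i t (x i t))⟫
        + ‖x i (t + 1) - mixed N x i t‖ ^ 2 / (2 * α (t + 1))
      ≤ (‖mixed N x i t - y‖ ^ 2 - ‖x i (t + 1) - y‖ ^ 2) / (2 * α (t + 1))
        + F₂ * (1 + ‖μ‖) * ‖x i (t + 1) - x i t‖
        + ((1 - β (t + 1) * γ (t + 1)) * ‖q i t - μ‖ ^ 2 - ‖q i (t + 1) - μ‖ ^ 2)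
            / (2 * γ (t + 1))
        + β (t + 1) * ‖μ‖ ^ 2 / 2 + γ (t + 1) * (F₁ + F₂ * (2 * R)) ^ 2 := by
  have hx := h.mem i ht
  have hx' := h.mem i (t := t + 1) (by omega)
  have hF₂ := hP.F₂_nonneg i
  set A := P.subGPos i t (x i t) with hA
  set u := x i (t + 1) - x i t with hu
  set b : Vec (m i) := pos (P.g i t (x i t)) + mulV Aᵀ u with hb
  have hprox := (h.x_step i t ht).two_mul_inner_le hP.convex_X hy
  have hdrift := dual_drift hβ hγ.le hβγ (q i t) b μ hμ
  rw [hb, ← h.q_step i t ht, ← hb] at hdrift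
  have hsub := hP.sub_f i t ht _ hx y hy
  have hu2 : ‖u‖ ≤ 2 * R := hP.norm_sub_le hx' hx
  have hAu : ‖mulV Aᵀ u‖ ≤ F₂ * ‖u‖ := hP.norm_mulV_subGPos_transpose_le i ht hx u
  have hbn : ‖b‖ ≤ F₁ + F₂ * (2 * R) := by
    refine (norm_add_le _ _).trans (add_le_add ((norm_pos_le _).trans (hP.bound_g i t ht _ hx)) ?_)
    exact hAu.trans (by gcongr)
  -- On a violated component convexity and g(y) ≤ 0 give g(x) ≤ ⟪∂g(x), x - y⟫; on a negative one
  -- both sides vanish, which is why those columns are set to zero.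
  have hqg : ⟪q i t, pos (P.g i t (x i t))⟫ ≤ ⟪q i t, mulV Aᵀ (x i t - y)⟫ := by
    rw [inner_eq_sum_mul, inner_eq_sum_mul]
    refine Finset.sum_le_sum fun k _ => mul_le_mul_of_nonneg_left ?_ (h.q_nonneg i ht k)
    rw [pos_apply, hA, OnlineProblem.mulV_subGPos_transpose_apply]
    split_ifs with hk
    · exact (max_eq_right hk.le).le
    · rw [max_eq_left (not_lt.1 hk)]
      have h1 := hP.sub_g i t ht _ hx k y hy
      rw [← neg_sub, inner_neg_right] at h1
      linarith [hgy k]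
  have hsplit : x i (t + 1) - y = (x i t - y) + u := by rw [hu]; abel
  have hmulV : mulV Aᵀ (x i t - y + u) = mulV Aᵀ (x i t - y) + mulV Aᵀ u := by
    simp [mulV, Matrix.mulVec_add]
  have hω : ⟪P.subF i t (x i t) + mulV A (q i t), x i (t + 1) - y⟫
      = ⟪P.subF i t (x i t), x i t - y⟫ + ⟪P.subF i t (x i t), u⟫
        + ⟪q i t, mulV Aᵀ (x i t - y)⟫ + ⟪q i t, mulV Aᵀ u⟫ := by
    rw [inner_add_left, inner_mulV, hsplit, hmulV, inner_add_right, inner_add_right]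
    ring
  have hfu : -(F₂ * ‖u‖) ≤ ⟪P.subF i t (x i t), u⟫ :=
    (abs_le.1 ((abs_real_inner_le_norm _ _).trans
      (mul_le_mul_of_nonneg_right (hP.bound_sub_f i t ht _ hx) (norm_nonneg u)))).1
  have hμu : -(‖μ‖ * (F₂ * ‖u‖)) ≤ ⟪μ, mulV Aᵀ u⟫ :=
    (abs_le.1 ((abs_real_inner_le_norm _ _).trans
      (mul_le_mul_of_nonneg_left hAu (norm_nonneg μ)))).1
  -- With `hqg`, ⟪q, b⟫ is at most the `q`-part of `hω`, so `q` drops out when the primal and dual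
  -- inequalities are added.
  have hqb : ⟪q i t, b⟫ = ⟪q i t, pos (P.g i t (x i t))⟫ + ⟪q i t, mulV Aᵀ u⟫ := inner_add_right ..
  have hμb : ⟪μ, b⟫ = ⟪μ, pos (P.g i t (x i t))⟫ + ⟪μ, mulV Aᵀ u⟫ := inner_add_right ..
  have hfy : P.f i t (x i t) - P.f i t y ≤ ⟪P.subF i t (x i t), x i t - y⟫ := by
    rw [← neg_sub, inner_neg_right] at hsub
    linarith
  have hbsq : γ (t + 1) * ‖b‖ ^ 2 ≤ γ (t + 1) * (F₁ + F₂ * (2 * R)) ^ 2 := by gcongr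
  have h1 : ⟪P.subF i t (x i t) + mulV A (q i t), x i (t + 1) - y⟫ ≤
      (‖mixed N x i t - y‖ ^ 2 - ‖x i (t + 1) - y‖ ^ 2) / (2 * α (t + 1))
        - ‖x i (t + 1) - mixed N x i t‖ ^ 2 / (2 * α (t + 1)) := by
    rw [← sub_div, le_div_iff₀ (by positivity), mul_comm]
    exact hprox
  have h2 : ⟪μ, b⟫ - ((1 - β (t + 1) * γ (t + 1)) * ‖q i t - μ‖ ^ 2 - ‖q i (t + 1) - μ‖ ^ 2)
            / (2 * γ (t + 1)) - β (t + 1) * ‖μ‖ ^ 2 / 2 - γ (t + 1) * ‖b‖ ^ 2 ≤ ⟪q i t, b⟫ := by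
    refine le_of_mul_le_mul_left ?_ (show 0 < 2 * γ (t + 1) by positivity)
    refine le_trans (le_of_eq ?_) hdrift
    field_simp
    ring
  have h3 : F₂ * (1 + ‖μ‖) * ‖u‖ = F₂ * ‖u‖ + ‖μ‖ * (F₂ * ‖u‖) := by ring
  linarith

end IsRun

end DistOCO

namespace DistOCO

/-! ### Products of mixing matrices -/

namespace Network

variable {n : ℕ} {N : Network n} {w : ℝ} {B : ℕ}

/-- The product `W_{t+k-1} ⋯ W_t`. -/
noncomputable def transition (N : Network n) (t : ℕ) : ℕ → Matrix (Fin n) (Fin n) ℝ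
  | 0 => 1
  | k + 1 => N.W (t + k) * transition N t k

namespace Regular

variable (hN : N.Regular w B)
include hN

theorem W_nonneg {t : ℕ} (ht : 1 ≤ t) (i j : Fin n) : 0 ≤ N.W t i j := by
  by_cases h : N.edge t j i ∨ i = j
  · exact (hN.weight_pos t ht i j h).le
  · exact (hN.weight_zero t ht i j h).ge

theorem le_W {t : ℕ} (ht : 1 ≤ t) {i j : Fin n} (h : N.edge t j i ∨ i = j) : w ≤ N.W t i j :=
  hN.weight_ge t ht i j (hN.weight_pos t ht i j h)

theorem transition_nonneg {t : ℕ} (ht : 1 ≤ t) (k : ℕ) (i j : Fin n) :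
    0 ≤ N.transition t k i j := by
  induction k generalizing i j with
  | zero =>
    rw [transition, Matrix.one_apply]
    split_ifs <;> norm_num
  | succ k ih =>
    rw [transition, Matrix.mul_apply]
    exact Finset.sum_nonneg fun l _ => mul_nonneg (hN.W_nonneg (by omega) i l) (ih l j)

theorem transition_row_sum {t : ℕ} (ht : 1 ≤ t) (k : ℕ) (i : Fin n) :
    ∑ j, N.transition t k i j = 1 := by
  induction k generalizing i with
  | zero => simp [transition, Matrix.one_apply]
  | succ k ih =>
    simp only [transition, Matrix.mul_apply]
    rw [Finset.sum_comm]
    simp only [← Finset.mul_sum, ih, mul_one]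
    exact hN.row_sum (t + k) (by omega) i

/-- A single term of the matrix product suffices: a path from `j` to `l` is extended by an edge to
`i`, or by staying put. -/
theorem pow_le_transition_succ (hw : 0 ≤ w) {t k : ℕ} (ht : 1 ≤ t) {i l j : Fin n}
    (hil : N.edge (t + k) l i ∨ i = l) (h : w ^ k ≤ N.transition t k l j) :
    w ^ (k + 1) ≤ N.transition t (k + 1) i j := by
  rw [transition, Matrix.mul_apply]
  refine le_trans ?_ (Finset.single_le_sum (f := fun l => N.W (t + k) i l * N.transition t k l j)
    (fun l _ => mul_nonneg (hN.W_nonneg (by omega) i l) (hN.transition_nonneg ht k l j))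
    (Finset.mem_univ l))
  rw [pow_succ']
  exact mul_le_mul (hN.le_W (by omega) hil) h (pow_nonneg hw k) (hN.W_nonneg (by omega) i l)

theorem pow_le_transition_add (hw : 0 ≤ w) {t k : ℕ} (ht : 1 ≤ t) {i j : Fin n}
    (h : w ^ k ≤ N.transition t k i j) (l : ℕ) :
    w ^ (k + l) ≤ N.transition t (k + l) i j := by
  induction l with
  | zero => exact h
  | succ l ih => exact hN.pow_le_transition_succ hw ht (Or.inr rfl) ih

/-- The set of agents reached from `j` with weight at least `w ^ k` gains a member in each
period of length `B` until it contains all agents. -/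
theorem le_card_reached (hw : 0 ≤ w) {t : ℕ} (ht : 1 ≤ t) (j : Fin n) (k : ℕ) :
    min n (k + 1) ≤
      (Finset.univ.filter fun i => w ^ (k * B) ≤ N.transition t (k * B) i j).card := by
  induction k with
  | zero =>
    refine (min_le_right _ _).trans (Finset.one_le_card.2 ⟨j, ?_⟩)
    simp [transition]
  | succ k ih =>
    set S := Finset.univ.filter fun i => w ^ (k * B) ≤ N.transition t (k * B) i j with hS
    set S' := Finset.univ.filter fun i => w ^ ((k + 1) * B) ≤ N.transition t ((k + 1) * B) i j
      with hS'
    have hsub : S ⊆ S' := fun i hi => by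
      rw [hS, Finset.mem_filter] at hi
      rw [hS', Finset.mem_filter, add_one_mul]
      exact ⟨Finset.mem_univ i, hN.pow_le_transition_add hw ht hi.2 B⟩
    by_cases hall : S = Finset.univ
    · have : S' = Finset.univ := Finset.univ_subset_iff.1 (hall ▸ hsub)
      rw [this, Finset.card_univ, Fintype.card_fin]
      exact min_le_left _ _
    · have hj : j ∈ S := by
        rw [hS, Finset.mem_filter]
        have := hN.pow_le_transition_add hw ht (k := 0) (i := j) (j := j)
          (by simp [transition]) (k * B)
        rw [zero_add] at this
        exact ⟨Finset.mem_univ j, this⟩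
      obtain ⟨b, hb⟩ : ∃ b, b ∉ S := by
        by_contra! hc
        exact hall (Finset.eq_univ_of_forall hc)
      -- A path from `j`, which lies in `S`, to an agent outside must contain an edge leaving `S`.
      -- The weight then waits at `a` for `l` rounds, crosses, and waits out the period through
      -- self-loops.
      have hcross : ∀ c, Relation.ReflTransGen
          (fun j i => ∃ l < B, N.edge (t + k * B + l) j i) j c → c ∉ S →
          ∃ a ∈ S, ∃ b, b ∉ S ∧ ∃ l < B, N.edge (t + k * B + l) a b := by
        intro c hc
        induction hc with
        | refl => exact fun h => absurd hj h
        | @tail c d _ hcd ih =>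
          intro hd
          by_cases hcS : c ∈ S
          · exact ⟨c, hcS, d, hd, hcd⟩
          · exact ih hcS
      obtain ⟨a, ha, b, hb, l, hl, hedge⟩ :=
        hcross b (hN.strongly_connected (t + k * B) (by omega) j b) hb
      have hb' : b ∈ S' := by
        rw [hS, Finset.mem_filter] at ha
        have h1 := hN.pow_le_transition_add hw ht ha.2 l
        have h2 := hN.pow_le_transition_succ hw ht (i := b) (Or.inl (by rwa [← add_assoc])) h1
        have h3 := hN.pow_le_transition_add hw ht h2 (B - (l + 1))
        have e : k * B + l + 1 + (B - (l + 1)) = (k + 1) * B := by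
          rw [add_one_mul]; omega
        rw [e] at h3
        rw [hS', Finset.mem_filter]
        exact ⟨Finset.mem_univ b, h3⟩
      have hlt : S.card < S'.card :=
        Finset.card_lt_card ⟨hsub, fun h => hb (h hb')⟩
      omega

theorem pow_le_transition (hw : 0 ≤ w) {t : ℕ} (ht : 1 ≤ t) (i j : Fin n) :
    w ^ (n * B) ≤ N.transition t (n * B) i j := by
  have h := hN.le_card_reached hw ht j n
  rw [min_eq_left (Nat.le_succ n)] at h
  have h2 := (Finset.card_eq_iff_eq_univ (Finset.univ.filter
    fun i => w ^ (n * B) ≤ N.transition t (n * B) i j)).1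
    (le_antisymm (Finset.card_le_univ _) (by simpa using h))
  have h3 := Finset.mem_univ i
  rw [← h2, Finset.mem_filter] at h3
  exact h3.2

end Regular

end Network

/-! ### Consensus -/

section Averages

variable {n : ℕ} {E : Type*} [NormedAddCommGroup E] [NormedSpace ℝ E]

theorem norm_sum_smul_le {a : Fin n → ℝ} (ha : ∀ i, 0 ≤ a i) (hs : ∑ i, a i = 1) {v : Fin n → E}
    {C : ℝ} (hv : ∀ i, ‖v i‖ ≤ C) : ‖∑ i, a i • v i‖ ≤ C :=
  calc ‖∑ i, a i • v i‖ ≤ ∑ i, a i * C := norm_sum_le_of_le _ fun i _ => by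
        rw [norm_smul, Real.norm_of_nonneg (ha i)]
        exact mul_le_mul_of_nonneg_left (hv i) (ha i)
    _ = C := by rw [← Finset.sum_mul, hs, one_mul]

/-- Two averages with weights at least `η` contract the diameter by the factor `1 - η`. -/
theorem norm_sum_smul_sub_sum_smul_le {a b : Fin n → ℝ} {η C : ℝ} (ha : ∀ i, 0 ≤ a i)
    (hη : ∀ i, η ≤ b i) (hb : ∀ i, 0 ≤ b i) (has : ∑ i, a i = 1) (hbs : ∑ i, b i = 1)
    {v : Fin n → E} (hC : 0 ≤ C) (hv : ∀ i j, ‖v i - v j‖ ≤ C) :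
    ‖∑ i, a i • v i - ∑ j, b j • v j‖ ≤ (1 - η) * C := by
  -- In this double average of differences the diagonal terms vanish, which saves b_i C ≥ ηC for
  -- each `i`.
  have e : ∑ i, a i • v i - ∑ j, b j • v j = ∑ i, a i • ∑ j, b j • (v i - v j) := by
    simp only [smul_sub, Finset.sum_sub_distrib, ← Finset.sum_smul, hbs, one_smul, has]
  rw [e]
  refine norm_sum_smul_le ha has fun i => ?_
  calc ‖∑ j, b j • (v i - v j)‖ ≤ ∑ j, (b j * C - if j = i then η * C else 0) := by
        refine norm_sum_le_of_le _ fun j _ => ?_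
        rw [norm_smul, Real.norm_of_nonneg (hb j)]
        split_ifs with h
        · subst h
          simpa using mul_le_mul_of_nonneg_right (hη j) hC
        · simpa using mul_le_mul_of_nonneg_left (hv i j) (hb j)
    _ = (1 - η) * C := by
        rw [Finset.sum_sub_distrib, ← Finset.sum_mul, hbs]
        simp [sub_mul]

end Averages

variable {n p : ℕ}

/-- The disagreement of the agents in round `t`. -/
noncomputable def disagreement (x : Fin n → ℕ → Vec p) (t : ℕ) : ℝ :=
  Metric.diam (Set.range fun i => x i t)

/-- The total length of the moves which the agents make in addition to averaging. -/
noncomputable def perturbation (N : Network n) (x : Fin n → ℕ → Vec p) (t : ℕ) : ℝ :=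
  ∑ i, ‖x i (t + 1) - mixed N x i t‖

theorem disagreement_nonneg (x : Fin n → ℕ → Vec p) (t : ℕ) : 0 ≤ disagreement x t :=
  Metric.diam_nonneg

theorem perturbation_nonneg (N : Network n) (x : Fin n → ℕ → Vec p) (t : ℕ) :
    0 ≤ perturbation N x t :=
  Finset.sum_nonneg fun _ _ => norm_nonneg _

theorem norm_sub_le_disagreement (x : Fin n → ℕ → Vec p) (t : ℕ) (i j : Fin n) :
    ‖x i t - x j t‖ ≤ disagreement x t := by
  rw [← dist_eq_norm]
  exact Metric.dist_le_diam_of_mem (Set.finite_range _).isBounded ⟨i, rfl⟩ ⟨j, rfl⟩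

theorem disagreement_le {x : Fin n → ℕ → Vec p} {t : ℕ} {C : ℝ} (hC : 0 ≤ C)
    (h : ∀ i j, ‖x i t - x j t‖ ≤ C) : disagreement x t ≤ C := by
  refine Metric.diam_le_of_forall_dist_le hC ?_
  rintro _ ⟨i, rfl⟩ _ ⟨j, rfl⟩
  rw [dist_eq_norm]
  exact h i j

namespace Network.Regular

variable {N : Network n} {w : ℝ} {B : ℕ} (hN : N.Regular w B)
include hN

/-- Each perturbation is carried on by row-stochastic matrices, which do not enlarge the largest
norm. No decay is needed, as only nB rounds are unrolled at a time. -/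
theorem norm_sub_transition_le (x : Fin n → ℕ → Vec p) {t : ℕ} (ht : 1 ≤ t) (k : ℕ) (i : Fin n) :
    ‖x i (t + k) - ∑ j, N.transition t k i j • x j t‖
      ≤ ∑ s ∈ Finset.range k, perturbation N x (t + s) := by
  induction k generalizing i with
  | zero => simp [transition, Matrix.one_apply]
  | succ k ih =>
    have e : x i (t + (k + 1)) - ∑ j, N.transition t (k + 1) i j • x j t
        = ∑ l, N.W (t + k) i l • (x l (t + k) - ∑ j, N.transition t k l j • x j t)
          + (x i (t + k + 1) - mixed N x i (t + k)) := by
      simp only [smul_sub, Finset.sum_sub_distrib, mixed, transition, Matrix.mul_apply,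
        Finset.sum_smul, Finset.smul_sum, smul_smul]
      rw [Finset.sum_comm, ← add_assoc]
      abel
    rw [e, Finset.sum_range_succ]
    refine (norm_add_le _ _).trans (add_le_add ?_ ?_)
    · exact norm_sum_smul_le (hN.W_nonneg (by omega) i) (hN.row_sum (t + k) (by omega) i) ih
    · exact Finset.single_le_sum (f := fun i => ‖x i (t + k + 1) - mixed N x i (t + k)‖)
        (fun _ _ => norm_nonneg _) (Finset.mem_univ i)

theorem disagreement_add_le (hw0 : 0 ≤ w) (hw1 : w ≤ 1) (x : Fin n → ℕ → Vec p) {t : ℕ}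
    (ht : 1 ≤ t) :
    disagreement x (t + n * B) ≤ (1 - w ^ (n * B)) * disagreement x t
      + 2 * ∑ s ∈ Finset.range (n * B), perturbation N x (t + s) := by
  have h0 := disagreement_nonneg x t
  have h1 : 0 ≤ 1 - w ^ (n * B) := sub_nonneg.2 (pow_le_one₀ hw0 hw1)
  have h2 : 0 ≤ ∑ s ∈ Finset.range (n * B), perturbation N x (t + s) :=
    Finset.sum_nonneg fun _ _ => perturbation_nonneg _ _ _
  refine disagreement_le (by positivity) fun i j => ?_
  have hi := hN.norm_sub_transition_le x ht (n * B) i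
  have hj := hN.norm_sub_transition_le x ht (n * B) j
  have hij := norm_sum_smul_sub_sum_smul_le (hN.transition_nonneg ht (n * B) i)
    (hN.pow_le_transition hw0 ht j) (hN.transition_nonneg ht (n * B) j)
    (hN.transition_row_sum ht (n * B) i) (hN.transition_row_sum ht (n * B) j) h0
    (norm_sub_le_disagreement x t)
  set zi := ∑ k, N.transition t (n * B) i k • x k t
  set zj := ∑ k, N.transition t (n * B) j k • x k t
  have e : x i (t + n * B) - x j (t + n * B)
      = (x i (t + n * B) - zi) - (x j (t + n * B) - zj) + (zi - zj) := by abel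
  rw [e]
  linarith [norm_add_le ((x i (t + n * B) - zi) - (x j (t + n * B) - zj)) (zi - zj),
    norm_sub_le (x i (t + n * B) - zi) (x j (t + n * B) - zj)]

/-- Averaging does not increase the total squared distance to a point. -/
theorem sum_norm_mixed_sub_sq_le (x : Fin n → ℕ → Vec p) {t : ℕ} (ht : 1 ≤ t) (y : Vec p) :
    ∑ i, ‖mixed N x i t - y‖ ^ 2 ≤ ∑ i, ‖x i t - y‖ ^ 2 := by
  have h1 : ∀ i, ‖mixed N x i t - y‖ ^ 2 ≤ ∑ j, N.W t i j * ‖x j t - y‖ ^ 2 := fun i => by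
    have e : mixed N x i t - y = ∑ j, N.W t i j • (x j t - y) := by
      simp only [smul_sub, Finset.sum_sub_distrib, ← Finset.sum_smul, hN.row_sum t ht i, one_smul,
        mixed]
    have hconv : ConvexOn ℝ Set.univ fun v : Vec p => ‖v‖ ^ 2 :=
      (convexOn_norm convex_univ).pow (fun _ _ => norm_nonneg _) 2
    rw [e]
    simpa using hconv.map_sum_le (t := Finset.univ) (w := N.W t i) (p := fun j => x j t - y)
      (fun j _ => hN.W_nonneg ht i j) (hN.row_sum t ht i) (fun _ _ => Set.mem_univ _)
  refine (Finset.sum_le_sum fun i _ => h1 i).trans (le_of_eq ?_)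
  -- Convexity of the squared norm used only the rows; summing over agents is the one place where
  -- the column sums enter.
  rw [Finset.sum_comm]
  simp only [← Finset.sum_mul, hN.col_sum t ht, one_mul]

theorem norm_mixed_sub_le (x : Fin n → ℕ → Vec p) {t : ℕ} (ht : 1 ≤ t) (i : Fin n) :
    ‖mixed N x i t - x i t‖ ≤ disagreement x t := by
  have e : mixed N x i t - x i t = ∑ j, N.W t i j • (x j t - x i t) := by
    simp only [smul_sub, Finset.sum_sub_distrib, ← Finset.sum_smul, hN.row_sum t ht i, one_smul,
      mixed]
  rw [e]
  exact norm_sum_smul_le (hN.W_nonneg ht i) (hN.row_sum t ht i) fun j =>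
    norm_sub_le_disagreement x t j i

end Network.Regular

/-- Summation of a perturbed contraction with delay `L`. -/
theorem mul_sum_le_of_delayed_contraction {d e : ℕ → ℝ} {K η : ℝ} {L : ℕ} (hη1 : η ≤ 1)
    (hd : ∀ t, 0 ≤ d t) (he : ∀ t, 0 ≤ e t) (hK : ∀ t, d t ≤ K)
    (h : ∀ t, d (t + L) ≤ (1 - η) * d t + 2 * ∑ s ∈ Finset.range L, e (t + s)) (T : ℕ) :
    η * ∑ t ∈ Finset.range T, d t ≤ L * K + 2 * L * ∑ t ∈ Finset.range T, e t := by
  have hbase : ∀ S, ∑ t ∈ Finset.range S, d t ≤ S * K := fun S =>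
    (Finset.sum_le_sum fun t _ => hK t).trans (by simp)
  have hK0 : 0 ≤ K := (hd 0).trans (hK 0)
  have he0 : 0 ≤ ∑ t ∈ Finset.range T, e t := Finset.sum_nonneg fun _ _ => he _
  have hd0 : 0 ≤ ∑ t ∈ Finset.range T, d t := Finset.sum_nonneg fun _ _ => hd _
  rcases le_total T L with hTL | hTL
  · have h1 : (T : ℝ) * K ≤ L * K := by gcongr
    have h2 : η * ∑ t ∈ Finset.range T, d t ≤ ∑ t ∈ Finset.range T, d t :=
      mul_le_of_le_one_left hd0 hη1
    have h3 : 0 ≤ 2 * L * ∑ t ∈ Finset.range T, e t := by positivity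
    linarith [hbase T]
  · obtain ⟨S, rfl⟩ := Nat.exists_eq_add_of_le hTL
    have h1 : ∑ t ∈ Finset.range S, d (L + t) ≤ (1 - η) * ∑ t ∈ Finset.range (L + S), d t
        + 2 * (L * ∑ t ∈ Finset.range (L + S), e t) := by
      calc ∑ t ∈ Finset.range S, d (L + t)
          ≤ ∑ t ∈ Finset.range S, ((1 - η) * d t + 2 * ∑ s ∈ Finset.range L, e (t + s)) :=
            Finset.sum_le_sum fun t _ => by rw [add_comm]; exact h t
        _ = (1 - η) * ∑ t ∈ Finset.range S, d t
            + 2 * ∑ s ∈ Finset.range L, ∑ t ∈ Finset.range S, e (t + s) := by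
            rw [Finset.sum_add_distrib, ← Finset.mul_sum, ← Finset.mul_sum, Finset.sum_comm]
        _ ≤ _ := by
            have h2 : ∑ t ∈ Finset.range S, d t ≤ ∑ t ∈ Finset.range (L + S), d t :=
              Finset.sum_le_sum_of_subset_of_nonneg
                (Finset.range_mono (by omega)) fun _ _ _ => hd _
            -- Each of the `L` shifted sums is part of the full sum, so every `e t` is counted at
            -- most `L` times.
            have h3 : ∀ s ∈ Finset.range L, ∑ t ∈ Finset.range S, e (t + s)
                ≤ ∑ t ∈ Finset.range (L + S), e t := fun s hs => by
              have hs' := Finset.mem_range.1 hs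
              have := Finset.sum_range_add_sum_Ico e (show s ≤ L + S by omega)
              rw [Finset.sum_Ico_eq_sum_range] at this
              have h4 : ∑ t ∈ Finset.range S, e (t + s)
                  ≤ ∑ t ∈ Finset.range (L + S - s), e (s + t) := by
                simp only [add_comm _ s]
                exact Finset.sum_le_sum_of_subset_of_nonneg
                  (Finset.range_mono (by omega)) fun _ _ _ => he _
              have h5 : 0 ≤ ∑ t ∈ Finset.range s, e t := Finset.sum_nonneg fun _ _ => he _
              linarith
            have h6 := Finset.sum_le_sum h3
            rw [Finset.sum_const, Finset.card_range, nsmul_eq_mul] at h6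
            have h7 : 0 ≤ 1 - η := by linarith
            gcongr
    rw [Finset.sum_range_add] at h1 ⊢
    have h2 := hbase L
    linarith

end DistOCO

namespace DistOCO

open scoped RealInnerProductSpace

/-! ### Sums -/

theorem sum_Icc_one_eq_sum_range {M : Type*} [AddCommMonoid M] (f : ℕ → M) (T : ℕ) :
    ∑ t ∈ Finset.Icc 1 T, f t = ∑ t ∈ Finset.range T, f (t + 1) := by
  induction T with
  | zero => simp
  | succ T ih => rw [Finset.sum_Icc_succ_top (by omega), Finset.sum_range_succ, ih]

/-- Bernoulli's inequality for the exponent `s` gives (T+1)^s - T^s ≥ s/(T+1)^r, so the right-hand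
side grows fast enough for induction. -/
theorem sum_one_div_rpow_le {r s : ℝ} (hs : 0 < s) (hr : 0 ≤ r) (hrs : r + s = 1) (T : ℕ) :
    ∑ t ∈ Finset.range T, 1 / ((t : ℝ) + 2) ^ r ≤ (T : ℝ) ^ s / s := by
  induction T with
  | zero => simp [Real.zero_rpow hs.ne']
  | succ T ih =>
    rw [Finset.sum_range_succ, Nat.cast_add_one]
    refine (add_le_add_left ih _).trans ?_
    have hT : (0 : ℝ) ≤ T := Nat.cast_nonneg T
    have hT1 : (0 : ℝ) < (T : ℝ) + 1 := by positivity
    have h1 : 1 + -1 / ((T : ℝ) + 1) = T / (T + 1) := by field_simp; ring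
    have h2 := rpow_one_add_le_one_add_mul_self (s := -1 / ((T : ℝ) + 1)) (p := s)
      (by rw [le_div_iff₀ hT1]; linarith) hs.le (by linarith)
    rw [h1, Real.div_rpow hT hT1.le, div_le_iff₀ (by positivity)] at h2
    have h3 : ((T : ℝ) + 1) ^ s / (T + 1) = 1 / ((T : ℝ) + 1) ^ r := by
      have : ((T : ℝ) + 1) ^ r * ((T : ℝ) + 1) ^ s = T + 1 := by
        rw [← Real.rpow_add hT1, hrs, Real.rpow_one]
      rw [div_eq_div_iff (by positivity) (by positivity)]
      linarith
    have h4 : 1 / ((T : ℝ) + 2) ^ r ≤ 1 / ((T : ℝ) + 1) ^ r := by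
      gcongr
      norm_num
    have h5 : (1 + s * (-1 / ((T : ℝ) + 1))) * ((T : ℝ) + 1) ^ s
        = ((T : ℝ) + 1) ^ s - s * (((T : ℝ) + 1) ^ s / (T + 1)) := by ring
    rw [h5, h3] at h2
    rw [div_add' _ _ _ hs.ne', div_le_div_iff_of_pos_right hs]
    have h6 := mul_le_mul_of_nonneg_left h4 hs.le
    linarith

/-- Summation by parts with nondecreasing weights. -/
theorem sum_mul_sub_le {c v : ℕ → ℝ} {K : ℝ} (hc : Monotone c) (hc0 : 0 ≤ c 0)
    (hv : ∀ t, v t ≤ K) (T : ℕ) :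
    ∑ t ∈ Finset.range T, c t * (v t - v (t + 1)) ≤ c T * (K - v T) := by
  induction T with
  | zero => simpa using mul_nonneg hc0 (sub_nonneg.2 (hv 0))
  | succ T ih =>
    rw [Finset.sum_range_succ]
    have h := mul_le_mul_of_nonneg_right (hc (Nat.le_succ T)) (sub_nonneg.2 (hv (T + 1)))
    simp only [Nat.succ_eq_add_one] at h
    linarith

/-- Since β_t γ_t = 1/t, this yields (1 - β_t γ_t)/γ_t ≤ 1/γ_{t-1}: the regularization makes the
weighted dual distances telescope despite growing weights. -/
theorem one_sub_one_div_mul_rpow_le {a s : ℝ} (ha : 1 ≤ a) (hs1 : s ≤ 1) :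
    (1 - 1 / a) * a ^ s ≤ (a - 1) ^ s := by
  have ha0 : 0 < a := by linarith
  have h0 : 0 ≤ 1 - 1 / a := by
    rw [sub_nonneg, div_le_one ha0]
    exact ha
  have h1 : 1 - 1 / a ≤ 1 := by
    have : 0 ≤ 1 / a := by positivity
    linarith
  have e : a - 1 = (1 - 1 / a) * a := by field_simp
  rw [e, Real.mul_rpow h0 ha0.le]
  exact mul_le_mul_of_nonneg_right (Real.self_le_rpow_of_le_one h0 h1 hs1)
    (Real.rpow_nonneg ha0.le s)

/-! ### The power step sizes and the energy estimate. -/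

variable {n p : ℕ} {m : Fin n → ℕ} {P : OnlineProblem n p m} {N : Network n}
  {x : Fin n → ℕ → Vec p} {q : (i : Fin n) → ℕ → Vec (m i)} {F₁ F₂ R w κ : ℝ} {B : ℕ}

/-- The iterates of the algorithm with the step sizes `α_t = β_t = t^{-κ}`, `γ_t = t^{-(1-κ)}`. -/
abbrev IsPowerRun (P : OnlineProblem n p m) (N : Network n) (κ : ℝ) (x : Fin n → ℕ → Vec p)
    (q : (i : Fin n) → ℕ → Vec (m i)) : Prop :=
  IsRun P N (fun t => 1 / (t : ℝ) ^ κ) (fun t => 1 / (t : ℝ) ^ κ)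
    (fun t => 1 / (t : ℝ) ^ (1 - κ)) x q

namespace IsPowerRun

/-- The free parameter `Λ` is the amount of perturbation to be absorbed. Counting `t` from 0, the
step sizes carry the index t + 2, so βγ ≤ 1/2 holds already in the first round. -/
theorem step_le (h : IsPowerRun P N κ x q) (hκ0 : 0 < κ) (hP : P.Regular F₁ F₂ R)
    (hN : N.Regular w B) (i : Fin n) (t : ℕ) {y : Vec p} (hy : y ∈ P.X)
    (hgy : ∀ k, P.g i (t + 1) y k ≤ 0) (μ : Vec (m i)) (hμ : ∀ k, 0 ≤ μ k) {ν : ℝ}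
    (hν : ‖μ‖ ≤ ν) (Λ : ℝ) :
    P.f i (t + 1) (x i (t + 1)) - P.f i (t + 1) y + ⟪μ, pos (P.g i (t + 1) (x i (t + 1)))⟫
        + Λ * ‖x i (t + 1 + 1) - mixed N x i (t + 1)‖
      ≤ ((t : ℝ) + 2) ^ κ / 2
          * (‖mixed N x i (t + 1) - y‖ ^ 2 - ‖x i (t + 1 + 1) - y‖ ^ 2)
        + F₂ * (1 + ν) * (‖x i (t + 1 + 1) - mixed N x i (t + 1)‖ + disagreement x (t + 1))
        + (((t : ℝ) + 1) ^ (1 - κ) / 2 * ‖q i (t + 1) - μ‖ ^ 2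
          - (((t + 1 : ℕ) : ℝ) + 1) ^ (1 - κ) / 2 * ‖q i (t + 1 + 1) - μ‖ ^ 2)
        + (ν ^ 2 + Λ ^ 2) / 2 * (1 / ((t : ℝ) + 2) ^ κ)
        + (F₁ + F₂ * (2 * R)) ^ 2 * (1 / ((t : ℝ) + 2) ^ (1 - κ)) := by
  have ht : (0 : ℝ) ≤ t := Nat.cast_nonneg t
  have ha : (0 : ℝ) < (t : ℝ) + 2 := by positivity
  have hcast : ((t + 1 + 1 : ℕ) : ℝ) = (t : ℝ) + 2 := by push_cast; ring
  have hcast' : (((t + 1 : ℕ) : ℝ) + 1) = (t : ℝ) + 2 := by push_cast; ring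
  have hprod : 1 / ((t : ℝ) + 2) ^ κ * (1 / ((t : ℝ) + 2) ^ (1 - κ)) = 1 / ((t : ℝ) + 2) := by
    rw [div_mul_div_comm, one_mul, ← Real.rpow_add ha, add_sub_cancel, Real.rpow_one]
  have hF₂ := hP.F₂_nonneg i
  have hpow := one_sub_one_div_mul_rpow_le (a := (t : ℝ) + 2) (s := 1 - κ) (by linarith)
    (by linarith)
  have e1 : (t : ℝ) + 2 - 1 = t + 1 := by ring
  have hmain := IsRun.step_le h hP i (t := t + 1) (by omega) (by simp only [hcast]; positivity)
    (by simp only [hcast]; positivity) (by simp only [hcast]; positivity)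
    (by
      simp only [hcast, hprod]
      rw [div_le_div_iff₀ ha two_pos]
      linarith) hy hgy μ hμ
  simp only [hcast, hprod] at hmain
  rw [hcast']
  set A := ((t : ℝ) + 2) ^ κ with hA
  set G := ((t : ℝ) + 2) ^ (1 - κ) with hG
  have hApos : 0 < A := Real.rpow_pos_of_pos ha _
  have hGpos : 0 < G := Real.rpow_pos_of_pos ha _
  set e := ‖x i (t + 1 + 1) - mixed N x i (t + 1)‖
  have hmove : ‖x i (t + 1 + 1) - x i (t + 1)‖ ≤ e + disagreement x (t + 1) := by
    have := norm_add_le (x i (t + 1 + 1) - mixed N x i (t + 1)) (mixed N x i (t + 1) - x i (t + 1))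
    rw [sub_add_sub_cancel] at this
    linarith [hN.norm_mixed_sub_le x (t := t + 1) (by omega) i]
  -- Young's inequality against the negative quadratic term left by the projection.
  have hyoung : Λ * e ≤ A / 2 * e ^ 2 + Λ ^ 2 / 2 * (1 / A) := by
    have : A / 2 * e ^ 2 + Λ ^ 2 / 2 * (1 / A) - Λ * e = (A * e - Λ) ^ 2 / (2 * A) := by
      field_simp
      ring
    have h0 : 0 ≤ (A * e - Λ) ^ 2 / (2 * A) := by positivity
    linarith
  have t1 : ∀ r : ℝ, r / (2 * (1 / A)) = A / 2 * r := fun r => by field_simp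
  have t2 : ∀ r : ℝ, r / (2 * (1 / G)) = G / 2 * r := fun r => by field_simp
  rw [t1, t1, t2] at hmain
  have hν0 : 0 ≤ ν := (norm_nonneg μ).trans hν
  have b1 : F₂ * (1 + ‖μ‖) * ‖x i (t + 1 + 1) - x i (t + 1)‖
      ≤ F₂ * (1 + ν) * (e + disagreement x (t + 1)) := by gcongr
  have b2 : 1 / A * ‖μ‖ ^ 2 / 2 ≤ 1 / A * ν ^ 2 / 2 := by gcongr
  have b3 := mul_le_mul_of_nonneg_right hpow (sq_nonneg ‖q i (t + 1) - μ‖)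
  rw [e1] at b3
  linarith

/-- The summed one-step inequality. -/
theorem sum_step_le (h : IsPowerRun P N κ x q) (hκ0 : 0 < κ) (hκ1 : κ < 1)
    (hP : P.Regular F₁ F₂ R) (hN : N.Regular w B) {T : ℕ} {y : Vec p}
    (hy : y ∈ P.staticFeasible T) (μ : (i : Fin n) → Vec (m i)) (hμ : ∀ i k, 0 ≤ μ i k) {ν : ℝ}
    (hν : ∀ i, ‖μ i‖ ≤ ν) (Λ : ℝ) :
    ∑ t ∈ Finset.range T, ∑ i, (P.f i (t + 1) (x i (t + 1)) - P.f i (t + 1) y)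
        + ∑ t ∈ Finset.range T, ∑ i, ⟪μ i, pos (P.g i (t + 1) (x i (t + 1)))⟫
        + Λ * ∑ t ∈ Finset.range T, perturbation N x (t + 1)
      ≤ ((T : ℝ) + 2) ^ κ / 2 * (n * (2 * R) ^ 2)
        + F₂ * (1 + ν) * (∑ t ∈ Finset.range T, perturbation N x (t + 1)
          + n * ∑ t ∈ Finset.range T, disagreement x (t + 1))
        + n * (ν ^ 2 / 2) + n * ((ν ^ 2 + Λ ^ 2) / 2) * ((T : ℝ) ^ (1 - κ) / (1 - κ))
        + n * (F₁ + F₂ * (2 * R)) ^ 2 * ((T : ℝ) ^ κ / κ) := by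
  set V : ℕ → ℝ := fun t => ∑ i, ‖x i (t + 1) - y‖ ^ 2 with hV
  set Q : ℕ → ℝ := fun t => ∑ i, ((t : ℝ) + 1) ^ (1 - κ) / 2 * ‖q i (t + 1) - μ i‖ ^ 2 with hQ
  have hstep : ∀ t ∈ Finset.range T,
      ∑ i, (P.f i (t + 1) (x i (t + 1)) - P.f i (t + 1) y)
        + ∑ i, ⟪μ i, pos (P.g i (t + 1) (x i (t + 1)))⟫ + Λ * perturbation N x (t + 1)
      ≤ ((t : ℝ) + 2) ^ κ / 2 * (V t - V (t + 1))
        + F₂ * (1 + ν) * (perturbation N x (t + 1) + n * disagreement x (t + 1))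
        + (Q t - Q (t + 1))
        + n * ((ν ^ 2 + Λ ^ 2) / 2) * (1 / ((t : ℝ) + 2) ^ κ)
        + n * (F₁ + F₂ * (2 * R)) ^ 2 * (1 / ((t : ℝ) + 2) ^ (1 - κ)) := by
    intro t ht
    have hsum := Finset.sum_le_sum fun i (_ : i ∈ Finset.univ) =>
      h.step_le hκ0 hP hN i t hy.1
        (fun k => hy.2 (t + 1) (Finset.mem_Icc.2 ⟨by omega, Finset.mem_range.1 ht⟩) ⟨i, k⟩)
        (μ i) (hμ i) (hν i) Λ
    have hmix := hN.sum_norm_mixed_sub_sq_le x (t := t + 1) (by omega) y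
    have hpow : 0 ≤ ((t : ℝ) + 2) ^ κ / 2 := by positivity
    have hmix' := mul_le_mul_of_nonneg_left hmix hpow
    simp only [Finset.sum_add_distrib, ← Finset.mul_sum, Finset.sum_sub_distrib, Finset.sum_const,
      Finset.card_univ, Fintype.card_fin, nsmul_eq_mul] at hsum
    simp only [hV, hQ, perturbation, ← Finset.mul_sum, Finset.sum_sub_distrib]
    linarith
  have hsum := Finset.sum_le_sum hstep
  simp only [Finset.sum_add_distrib, ← Finset.mul_sum] at hsum
  have hVK : ∀ t, V t ≤ n * (2 * R) ^ 2 := fun t => by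
    have : ∀ i ∈ Finset.univ, ‖x i (t + 1) - y‖ ^ 2 ≤ (2 * R) ^ 2 := fun i _ => by
      have := hP.norm_sub_le (h.mem i (t := t + 1) (by omega)) hy.1
      gcongr
    simpa using Finset.sum_le_sum this
  have hV0 : 0 ≤ V T := Finset.sum_nonneg fun _ _ => sq_nonneg _
  -- The primal weights 1/(2α) increase, so summation by parts uses the diameter of `P.X` and costs
  -- the last weight.
  have hprimal := sum_mul_sub_le (c := fun t : ℕ => ((t : ℝ) + 2) ^ κ / 2)
    (fun s t hst => by
      have : (s : ℝ) ≤ t := Nat.cast_le.2 hst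
      dsimp only
      gcongr) (by positivity) hVK T
  have hprimal' : ((T : ℝ) + 2) ^ κ / 2 * (n * (2 * R) ^ 2 - V T)
      ≤ ((T : ℝ) + 2) ^ κ / 2 * (n * (2 * R) ^ 2) := by
    gcongr
    linarith
  have hQ0 : Q 0 ≤ n * (ν ^ 2 / 2) := by
    have : ∀ i ∈ Finset.univ, (((0 : ℕ) : ℝ) + 1) ^ (1 - κ) / 2 * ‖q i (0 + 1) - μ i‖ ^ 2
        ≤ ν ^ 2 / 2 := fun i _ => by
      rw [zero_add, h.q_init i, zero_sub, norm_neg, Nat.cast_zero, zero_add, Real.one_rpow]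
      have := pow_le_pow_left₀ (norm_nonneg _) (hν i) 2
      linarith
    exact (Finset.sum_le_sum this).trans (by simp)
  have hQT : 0 ≤ Q T := Finset.sum_nonneg fun _ _ => by positivity
  rw [Finset.sum_range_sub'] at hsum
  have hα := sum_one_div_rpow_le (r := κ) (s := 1 - κ) (by linarith) hκ0.le (by ring) T
  have hγ := sum_one_div_rpow_le (r := 1 - κ) (s := κ) hκ0 (by linarith) (by ring) T
  have b1 := mul_le_mul_of_nonneg_left hα (show 0 ≤ n * ((ν ^ 2 + Λ ^ 2) / 2) by positivity)
  have b2 := mul_le_mul_of_nonneg_left hγ (show 0 ≤ n * (F₁ + F₂ * (2 * R)) ^ 2 by positivity)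
  linarith

/-- The accumulated disagreement is controlled by the accumulated perturbation. -/
theorem sum_disagreement_le (h : IsPowerRun P N κ x q) (hP : P.Regular F₁ F₂ R)
    (hN : N.Regular w B) (hw0 : 0 < w) (hw1 : w ≤ 1) (T : ℕ) :
    ∑ t ∈ Finset.range T, disagreement x (t + 1)
      ≤ 2 * R * (n * B) / w ^ (n * B)
        + 2 * (n * B) / w ^ (n * B) * ∑ t ∈ Finset.range T, perturbation N x (t + 1) := by
  have h1 := mul_sum_le_of_delayed_contraction (d := fun t => disagreement x (t + 1))
    (e := fun t => perturbation N x (t + 1)) (K := 2 * R) (η := w ^ (n * B)) (L := n * B)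
    (pow_le_one₀ hw0.le hw1) (fun t => disagreement_nonneg x _)
    (fun t => perturbation_nonneg N x _)
    (fun t => disagreement_le (by linarith [hP.R_nonneg]) fun i j =>
      hP.norm_sub_le (h.mem i (by omega)) (h.mem j (by omega)))
    (fun t => by
      have := hN.disagreement_add_le hw0.le hw1 x (t := t + 1) (by omega)
      simpa only [add_right_comm] using this) T
  have hη : 0 < w ^ (n * B) := pow_pos hw0 _
  rw [mul_comm, ← le_div_iff₀ hη] at h1
  refine h1.trans (le_of_eq ?_)
  push_cast
  ring

/-- The energy estimate behind both the regret bound and the constraint violation bound. -/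
theorem energy_le (h : IsPowerRun P N κ x q) (hκ0 : 0 < κ) (hκ1 : κ < 1)
    (hP : P.Regular F₁ F₂ R) (hF₂ : 0 ≤ F₂) {c₀ c₁ : ℝ} {T : ℕ} (hT : 1 ≤ T)
    (hN : N.Regular w B) (hD : ∑ t ∈ Finset.range T, disagreement x (t + 1)
      ≤ c₀ + c₁ * ∑ t ∈ Finset.range T, perturbation N x (t + 1))
    {y : Vec p} (hy : y ∈ P.staticFeasible T) (μ : (i : Fin n) → Vec (m i))
    (hμ : ∀ i k, 0 ≤ μ i k) {ν : ℝ} (hν0 : 0 ≤ ν) (hν : ∀ i, ‖μ i‖ ≤ ν) (lam : ℝ) :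
    ∑ t ∈ Finset.range T, ∑ i, (P.f i (t + 1) (x i (t + 1)) - P.f i (t + 1) y)
        + ∑ t ∈ Finset.range T, ∑ i, ⟪μ i, pos (P.g i (t + 1) (x i (t + 1)))⟫
        + lam * ∑ t ∈ Finset.range T, perturbation N x (t + 1)
      ≤ n * (3 / 2 * (2 * R) ^ 2 + (F₁ + F₂ * (2 * R)) ^ 2 / κ) * (T : ℝ) ^ κ
        + F₂ * (1 + ν) * (n * c₀) + n * ν ^ 2 / 2
        + n * (ν ^ 2 + (lam + F₂ * (1 + ν) * (1 + n * c₁)) ^ 2) / (2 * (1 - κ))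
          * (T : ℝ) ^ (1 - κ) := by
  have hT' : (1 : ℝ) ≤ T := by exact_mod_cast hT
  have h1 := h.sum_step_le hκ0 hκ1 hP hN hy μ hμ hν (lam + F₂ * (1 + ν) * (1 + n * c₁))
  have h2 : ((T : ℝ) + 2) ^ κ ≤ 3 * (T : ℝ) ^ κ := by
    calc ((T : ℝ) + 2) ^ κ ≤ (3 * (T : ℝ)) ^ κ := by
          gcongr
          linarith
      _ = 3 ^ κ * (T : ℝ) ^ κ := Real.mul_rpow (by norm_num) (by positivity)
      _ ≤ 3 * (T : ℝ) ^ κ := by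
          gcongr
          exact Real.rpow_le_self_of_one_le (by norm_num) hκ1.le
  have h3 : ((T : ℝ) + 2) ^ κ / 2 * (n * (2 * R) ^ 2)
      ≤ 3 * (T : ℝ) ^ κ / 2 * (n * (2 * R) ^ 2) := by gcongr
  have h4 := mul_le_mul_of_nonneg_left hD (show 0 ≤ F₂ * (1 + ν) * n by positivity)
  have hκ' : 1 - κ ≠ 0 := by linarith
  have e1 : n * ((ν ^ 2 + (lam + F₂ * (1 + ν) * (1 + n * c₁)) ^ 2) / 2)
      * ((T : ℝ) ^ (1 - κ) / (1 - κ))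
      = n * (ν ^ 2 + (lam + F₂ * (1 + ν) * (1 + n * c₁)) ^ 2) / (2 * (1 - κ))
          * (T : ℝ) ^ (1 - κ) := by
    field_simp
  rw [e1] at h1
  have e2 : n * (F₁ + F₂ * (2 * R)) ^ 2 * ((T : ℝ) ^ κ / κ)
      = n * ((F₁ + F₂ * (2 * R)) ^ 2 / κ) * (T : ℝ) ^ κ := by ring
  rw [e2] at h1
  linarith

/-! ### From the energy estimate to regret and violation. -/

/-- The regret evaluates `f_j` at the decision of every agent `i`, while the energy estimate sees it
only at agent `j`; the Lipschitz bound makes up the difference. -/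
theorem mul_netReg_le (h : IsPowerRun P N κ x q) (hn : 0 < n) (hP : P.Regular F₁ F₂ R)
    {y : Vec p} (T : ℕ) :
    n * P.netReg T x (fun _ => y)
      ≤ ∑ t ∈ Finset.range T, ∑ i, (P.f i (t + 1) (x i (t + 1)) - P.f i (t + 1) y)
        + n * F₂ * ∑ t ∈ Finset.range T, disagreement x (t + 1) := by
  have hn' : (0 : ℝ) < n := Nat.cast_pos.2 hn
  have hF₂ := hP.F₂_nonneg ⟨0, hn⟩
  have key : ∀ i, ∀ t, P.globalLoss (t + 1) (x i (t + 1)) - P.globalLoss (t + 1) y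
      ≤ (1 / (n : ℝ)) * ∑ j, (P.f j (t + 1) (x j (t + 1)) - P.f j (t + 1) y)
        + F₂ * disagreement x (t + 1) := fun i t => by
    unfold OnlineProblem.globalLoss
    rw [← mul_sub, ← Finset.sum_sub_distrib]
    have : ∀ j ∈ Finset.univ, P.f j (t + 1) (x i (t + 1)) - P.f j (t + 1) y
        ≤ (P.f j (t + 1) (x j (t + 1)) - P.f j (t + 1) y) + F₂ * disagreement x (t + 1) :=
      fun j _ => by
        have h1 := (abs_le.1 (hP.abs_f_sub_le j (t := t + 1) (by omega)
          (h.mem i (t := t + 1) (by omega)) (h.mem j (t := t + 1) (by omega)))).2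
        have h2 := mul_le_mul_of_nonneg_left (norm_sub_le_disagreement x (t + 1) i j) hF₂
        linarith
    have h3 := Finset.sum_le_sum this
    rw [Finset.sum_add_distrib, Finset.sum_const, Finset.card_univ, Fintype.card_fin,
      nsmul_eq_mul] at h3
    refine (mul_le_mul_of_nonneg_left h3 (by positivity)).trans (le_of_eq ?_)
    field_simp
  have h1 : ∀ i ∈ Finset.univ, ∑ t ∈ Finset.range T, (P.globalLoss (t + 1) (x i (t + 1))
        - P.globalLoss (t + 1) y)
      ≤ (1 / (n : ℝ)) * ∑ t ∈ Finset.range T, ∑ j, (P.f j (t + 1) (x j (t + 1)) - P.f j (t + 1) y)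
        + F₂ * ∑ t ∈ Finset.range T, disagreement x (t + 1) := fun i _ => by
    rw [Finset.mul_sum, Finset.mul_sum, ← Finset.sum_add_distrib]
    exact Finset.sum_le_sum fun t _ => key i t
  have h2 := Finset.sum_le_sum h1
  simp only [Finset.sum_sub_distrib, Finset.sum_const, Finset.card_univ, Fintype.card_fin,
      nsmul_eq_mul] at h2 ⊢
  rw [OnlineProblem.netReg, sum_Icc_one_eq_sum_range]
  simp only [sum_Icc_one_eq_sum_range]
  field_simp at h2 ⊢
  linarith

/-- The Euclidean norm is bounded by the sum over all scalar constraints, each moved to its own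
agent by the Lipschitz bound. -/
theorem netViolation_le (h : IsPowerRun P N κ x q) (hn : 0 < n) (hP : P.Regular F₁ F₂ R) {T : ℕ}
    {G : ℝ} (hG : ∀ j k, ∑ t ∈ Finset.range T, pos (P.g j (t + 1) (x j (t + 1))) k ≤ G) :
    P.netViolation T x
      ≤ (∑ j, m j : ℕ) * (G + F₂ * ∑ t ∈ Finset.range T, disagreement x (t + 1)) := by
  have hn' : (0 : ℝ) < n := Nat.cast_pos.2 hn
  have hF₂ := hP.F₂_nonneg ⟨0, hn⟩
  have key : ∀ i, ∀ t, ‖pos (P.globalConstraint (t + 1) (x i (t + 1)))‖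
      ≤ ∑ s : (j : Fin n) × Fin (m j), (pos (P.g s.1 (t + 1) (x s.1 (t + 1))) s.2
          + F₂ * disagreement x (t + 1)) := fun i t => by
    refine (norm_le_sum_abs _).trans (Finset.sum_le_sum fun s _ => ?_)
    rw [pos_apply, pos_apply, abs_of_nonneg (le_max_right _ _)]
    have h1 := (abs_le.1 (hP.abs_g_sub_le s.1 (t := t + 1) (by omega) s.2
          (h.mem i (t := t + 1) (by omega)) (h.mem s.1 (t := t + 1) (by omega)))).2
    have h2 := mul_le_mul_of_nonneg_left (norm_sub_le_disagreement x (t + 1) i s.1) hF₂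
    have h3 : 0 ≤ F₂ * disagreement x (t + 1) := mul_nonneg hF₂ (disagreement_nonneg _ _)
    have h4 := le_max_left (P.g s.1 (t + 1) (x s.1 (t + 1)) s.2) 0
    have h5 := le_max_right (P.g s.1 (t + 1) (x s.1 (t + 1)) s.2) 0
    refine max_le ?_ (by linarith)
    change P.g s.1 (t + 1) (x i (t + 1)) s.2 ≤ _
    linarith
  have hagent : ∀ i ∈ Finset.univ,
      ∑ t ∈ Finset.range T, ‖pos (P.globalConstraint (t + 1) (x i (t + 1)))‖
      ≤ (∑ j, m j : ℕ) * (G + F₂ * ∑ t ∈ Finset.range T, disagreement x (t + 1)) := fun i _ => by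
    refine (Finset.sum_le_sum fun t _ => key i t).trans ?_
    rw [Finset.sum_comm]
    have : ∀ s ∈ (Finset.univ : Finset ((j : Fin n) × Fin (m j))),
        ∑ t ∈ Finset.range T, (pos (P.g s.1 (t + 1) (x s.1 (t + 1))) s.2
          + F₂ * disagreement x (t + 1))
        ≤ G + F₂ * ∑ t ∈ Finset.range T, disagreement x (t + 1) := fun s _ => by
      rw [Finset.sum_add_distrib, ← Finset.mul_sum]
      exact add_le_add (hG s.1 s.2) le_rfl
    refine (Finset.sum_le_sum this).trans (le_of_eq ?_)
    rw [Finset.sum_const, nsmul_eq_mul, Finset.card_univ, Fintype.card_sigma]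
    simp only [Fintype.card_fin]
  have hsum := Finset.sum_le_sum hagent
  rw [Finset.sum_const, Finset.card_univ, Fintype.card_fin, nsmul_eq_mul] at hsum
  rw [OnlineProblem.netViolation]
  simp only [sum_Icc_one_eq_sum_range]
  rw [one_div, inv_mul_le_iff₀ hn']
  exact hsum

/-- The regret bound, given a linear bound of the disagreement by the perturbation. -/
theorem netReg_le (h : IsPowerRun P N κ x q) (hn : 0 < n) (hκ0 : 0 < κ) (hκ1 : κ < 1)
    (hP : P.Regular F₁ F₂ R) (hN : N.Regular w B) {c₀ c₁ : ℝ} (hc₀ : 0 ≤ c₀) {T : ℕ} (hT : 1 ≤ T)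
    (hD : ∑ t ∈ Finset.range T, disagreement x (t + 1)
      ≤ c₀ + c₁ * ∑ t ∈ Finset.range T, perturbation N x (t + 1))
    {y : Vec p} (hy : y ∈ P.staticFeasible T) :
    P.netReg T x (fun _ => y)
      ≤ (3 / 2 * (2 * R) ^ 2 + (F₁ + F₂ * (2 * R)) ^ 2 / κ + 2 * F₂ * c₀
        + (n * F₂ * c₁ + F₂ * (1 + n * c₁)) ^ 2 / (2 * (1 - κ))) * (T : ℝ) ^ max κ (1 - κ) := by
  have hn' : (0 : ℝ) < n := Nat.cast_pos.2 hn
  have hT' : (1 : ℝ) ≤ T := by exact_mod_cast hT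
  have hF₂ := hP.F₂_nonneg ⟨0, hn⟩
  have hκ1' : 0 < 1 - κ := by linarith
  have hreg := h.mul_netReg_le hn hP (y := y) T
  -- The surplus nF₂c₁ pays for the disagreement in `hreg`; its constant part makes c₀ appear twice
  -- in the bound.
  have hen := h.energy_le hκ0 hκ1 hP hF₂ hT hN hD hy (fun _ => 0) (fun _ _ => le_rfl) le_rfl
    (fun i => by simp) (n * F₂ * c₁)
  simp only [inner_zero_left, Finset.sum_const_zero, add_zero, mul_one,
    ne_eq, OfNat.ofNat_ne_zero, not_false_eq_true, zero_pow, mul_zero, zero_div, zero_add] at hen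
  have hD' := mul_le_mul_of_nonneg_left hD (show 0 ≤ n * F₂ by positivity)
  set M := (T : ℝ) ^ max κ (1 - κ)
  have b1 : (T : ℝ) ^ κ ≤ M := Real.rpow_le_rpow_of_exponent_le hT' (le_max_left _ _)
  have b2 : (T : ℝ) ^ (1 - κ) ≤ M := Real.rpow_le_rpow_of_exponent_le hT' (le_max_right _ _)
  have b3 : 1 ≤ M := Real.one_le_rpow hT' (hκ0.le.trans (le_max_left _ _))
  have a1 := mul_le_mul_of_nonneg_left b1
    (show 0 ≤ n * (3 / 2 * (2 * R) ^ 2 + (F₁ + F₂ * (2 * R)) ^ 2 / κ) by positivity)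
  have a2 := mul_le_mul_of_nonneg_left b2
    (show 0 ≤ n * (n * F₂ * c₁ + F₂ * (1 + n * c₁)) ^ 2 / (2 * (1 - κ)) by positivity)
  have a3 := mul_le_mul_of_nonneg_left b3 (show 0 ≤ 2 * (n * F₂ * c₀) by positivity)
  refine le_of_mul_le_mul_left (hreg.trans ?_) hn'
  have e : n * ((3 / 2 * (2 * R) ^ 2 + (F₁ + F₂ * (2 * R)) ^ 2 / κ + 2 * F₂ * c₀
        + (n * F₂ * c₁ + F₂ * (1 + n * c₁)) ^ 2 / (2 * (1 - κ))) * M)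
      = n * (3 / 2 * (2 * R) ^ 2 + (F₁ + F₂ * (2 * R)) ^ 2 / κ) * M + 2 * (n * F₂ * c₀) * M
        + n * (n * F₂ * c₁ + F₂ * (1 + n * c₁)) ^ 2 / (2 * (1 - κ)) * M := by ring
  rw [e]
  linarith

/-- The accumulated violation of a single constraint by its own agent, together with the
accumulated perturbation. -/
theorem sum_pos_add_sum_perturbation_le (h : IsPowerRun P N κ x q) (hκ0 : 0 < κ)
    (hκ1 : κ < 1) (hP : P.Regular F₁ F₂ R) (hN : N.Regular w B) {c₀ c₁ : ℝ} (hc₀ : 0 ≤ c₀)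
    (hc₁ : 0 ≤ c₁) {T : ℕ} (hT : 1 ≤ T)
    (hD : ∑ t ∈ Finset.range T, disagreement x (t + 1)
      ≤ c₀ + c₁ * ∑ t ∈ Finset.range T, perturbation N x (t + 1))
    (hfeas : (P.staticFeasible T).Nonempty) (j : Fin n) (k : Fin (m j)) :
    ∑ t ∈ Finset.range T, pos (P.g j (t + 1) (x j (t + 1))) k
        + ∑ t ∈ Finset.range T, perturbation N x (t + 1)
      ≤ (n * F₁ + n * (3 / 2 * (2 * R) ^ 2 + (F₁ + F₂ * (2 * R)) ^ 2 / κ)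
          + 2 * F₂ * (n * c₀) + n / 2
          + n * (1 + (1 + 2 * F₂ * (1 + n * c₁)) ^ 2) / (2 * (1 - κ)))
        * (T : ℝ) ^ (1 - κ / 2) := by
  obtain ⟨y, hy⟩ := hfeas
  have hT' : (1 : ℝ) ≤ T := by exact_mod_cast hT
  have hT0 : (0 : ℝ) < T := by linarith
  have hF₁ := hP.F₁_nonneg j
  have hF₂ := hP.F₂_nonneg j
  have hκ1' : 0 < 1 - κ := by linarith
  -- The largest order of multiplier for which the cost s² T^(1-κ) is still O(T).
  set s := (T : ℝ) ^ (κ / 2) with hs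
  have hs1 : 1 ≤ s := Real.one_le_rpow hT' (by linarith)
  have hs0 : 0 < s := by linarith
  have hss : s ^ 2 = (T : ℝ) ^ κ := by
    rw [hs, ← Real.rpow_natCast, ← Real.rpow_mul hT0.le]
    norm_num
  have hsT : s * (T : ℝ) ^ (1 - κ / 2) = T := by
    rw [hs, ← Real.rpow_add hT0, add_sub_cancel, Real.rpow_one]
  have hssT : s ^ 2 * (T : ℝ) ^ (1 - κ) = T := by
    rw [hss, ← Real.rpow_add hT0, add_sub_cancel, Real.rpow_one]
  have hκT : (T : ℝ) ^ κ ≤ T := Real.rpow_le_self_of_one_le hT' hκ1.le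
  have hsleT : s ≤ T := Real.rpow_le_self_of_one_le hT' (by linarith)
  set μ : (i : Fin n) → Vec (m i) :=
    Function.update (fun i => (0 : Vec (m i))) j (EuclideanSpace.single k s) with hμdef
  have hμj : μ j = EuclideanSpace.single k s := Function.update_self ..
  have hμi : ∀ i, i ≠ j → μ i = 0 := fun i hi => Function.update_of_ne hi ..
  have hμ0 : ∀ i k, 0 ≤ μ i k := fun i l => by
    by_cases hi : i = j
    · subst hi
      rw [hμj, PiLp.single_apply]
      split_ifs
      · exact hs0.le
      · exact le_rfl
    · rw [hμi i hi]
      exact le_rfl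
  have hμn : ∀ i, ‖μ i‖ ≤ s := fun i => by
    by_cases hi : i = j
    · subst hi
      rw [hμj, PiLp.norm_single, Real.norm_of_nonneg hs0.le]
    · rw [hμi i hi, norm_zero]
      exact hs0.le
  have hen := h.energy_le hκ0 hκ1 hP hF₂ hT hN hD hy μ hμ0 hs0.le hμn s
  have hinner : ∀ t, ∑ i, ⟪μ i, pos (P.g i (t + 1) (x i (t + 1)))⟫
      = s * pos (P.g j (t + 1) (x j (t + 1))) k := fun t => by
    rw [Finset.sum_eq_single j (fun i _ hi => by rw [hμi i hi, inner_zero_left])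
      (fun hj => absurd (Finset.mem_univ j) hj), hμj, EuclideanSpace.inner_single_left]
    simp
  simp only [hinner, ← Finset.mul_sum] at hen
  -- The loss differences may be negative, but only linearly in `T`.
  have hS : -(n * F₁ * T)
      ≤ ∑ t ∈ Finset.range T, ∑ i, (P.f i (t + 1) (x i (t + 1)) - P.f i (t + 1) y) := by
    have h1 : ∀ t ∈ Finset.range T,
        -(n * F₁) ≤ ∑ i, (P.f i (t + 1) (x i (t + 1)) - P.f i (t + 1) y) := fun t _ => by
      have : ∀ i ∈ Finset.univ, -F₁ ≤ P.f i (t + 1) (x i (t + 1)) - P.f i (t + 1) y :=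
        fun i _ => (abs_le.1 (hP.bound_f i (t + 1) (by omega) _ (h.mem i (by omega)) _ hy.1)).1
      have := Finset.sum_le_sum this
      simpa using this
    have h2 := Finset.sum_le_sum h1
    rw [Finset.sum_const, Finset.card_range, nsmul_eq_mul] at h2
    linarith
  have a1 := mul_le_mul_of_nonneg_left hκT
    (show 0 ≤ n * (3 / 2 * (2 * R) ^ 2 + (F₁ + F₂ * (2 * R)) ^ 2 / κ) by positivity)
  have a2 : F₂ * (1 + s) * (n * c₀) ≤ 2 * F₂ * (n * c₀) * T := by
    have : F₂ * (1 + s) * (n * c₀) = F₂ * (n * c₀) * (1 + s) := by ring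
    have h2 := mul_le_mul_of_nonneg_left (show 1 + s ≤ 2 * T by linarith)
      (show 0 ≤ F₂ * (n * c₀) by positivity)
    linarith
  have a3 : n * s ^ 2 / 2 ≤ n / 2 * T := by
    rw [hss]
    have := mul_le_mul_of_nonneg_left hκT (show (0 : ℝ) ≤ n / 2 by positivity)
    linarith
  have a4 : n * (s ^ 2 + (s + F₂ * (1 + s) * (1 + n * c₁)) ^ 2) / (2 * (1 - κ))
        * (T : ℝ) ^ (1 - κ)
      ≤ n * (1 + (1 + 2 * F₂ * (1 + n * c₁)) ^ 2) / (2 * (1 - κ)) * T := by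
    have h1 : s + F₂ * (1 + s) * (1 + n * c₁) ≤ s * (1 + 2 * F₂ * (1 + n * c₁)) := by
      have := mul_le_mul_of_nonneg_left (show 1 + s ≤ 2 * s by linarith)
        (show 0 ≤ F₂ * (1 + n * c₁) by positivity)
      linarith
    have h2 : (s + F₂ * (1 + s) * (1 + n * c₁)) ^ 2
        ≤ (s * (1 + 2 * F₂ * (1 + n * c₁))) ^ 2 := by gcongr
    calc n * (s ^ 2 + (s + F₂ * (1 + s) * (1 + n * c₁)) ^ 2) / (2 * (1 - κ)) * (T : ℝ) ^ (1 - κ)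
        ≤ n * (s ^ 2 + (s * (1 + 2 * F₂ * (1 + n * c₁))) ^ 2) / (2 * (1 - κ))
            * (T : ℝ) ^ (1 - κ) := by gcongr
      _ = n * (1 + (1 + 2 * F₂ * (1 + n * c₁)) ^ 2) / (2 * (1 - κ))
            * (s ^ 2 * (T : ℝ) ^ (1 - κ)) := by ring
      _ = _ := by rw [hssT]
  -- Multiplier and surplus both equal `s`, so both sums carry this factor; the right-hand side
  -- becomes a constant times `T`.
  refine le_of_mul_le_mul_left ?_ hs0
  rw [mul_left_comm s, hsT]
  linarith

/-- The violation bound, given a linear bound of the disagreement by the perturbation. -/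
theorem netViolation_le_mul_rpow (h : IsPowerRun P N κ x q) (hn : 0 < n) (hκ1 : κ < 1)
    (hP : P.Regular F₁ F₂ R) {c₀ c₁ K : ℝ} (hc₀ : 0 ≤ c₀) (hc₁ : 0 ≤ c₁)
    {T : ℕ} (hT : 1 ≤ T)
    (hD : ∑ t ∈ Finset.range T, disagreement x (t + 1)
      ≤ c₀ + c₁ * ∑ t ∈ Finset.range T, perturbation N x (t + 1))
    (hm : ∀ i, 0 < m i)
    (hK : ∀ j k, ∑ t ∈ Finset.range T, pos (P.g j (t + 1) (x j (t + 1))) k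
        + ∑ t ∈ Finset.range T, perturbation N x (t + 1) ≤ K * (T : ℝ) ^ (1 - κ / 2)) :
    P.netViolation T x
      ≤ (∑ j, m j : ℕ) * (K + F₂ * (c₀ + c₁ * K)) * (T : ℝ) ^ (1 - κ / 2) := by
  have hT' : (1 : ℝ) ≤ T := by exact_mod_cast hT
  have hF₂ := hP.F₂_nonneg ⟨0, hn⟩
  have hG0 : ∀ j k, 0 ≤ ∑ t ∈ Finset.range T, pos (P.g j (t + 1) (x j (t + 1))) k := fun j k =>
    Finset.sum_nonneg fun _ _ => le_max_right _ _
  have hE0 : 0 ≤ ∑ t ∈ Finset.range T, perturbation N x (t + 1) :=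
    Finset.sum_nonneg fun _ _ => perturbation_nonneg _ _ _
  set M := (T : ℝ) ^ (1 - κ / 2)
  have hM : 1 ≤ M := Real.one_le_rpow hT' (by linarith)
  -- Any one constraint will do here, since its accumulated violation is nonnegative; `hm` ensures
  -- that one exists.
  have hE : ∑ t ∈ Finset.range T, perturbation N x (t + 1) ≤ K * M := by
    linarith [hK ⟨0, hn⟩ ⟨0, hm _⟩, hG0 ⟨0, hn⟩ ⟨0, hm _⟩]
  refine (h.netViolation_le hn hP (G := K * M) fun j k => by linarith [hK j k]).trans ?_
  rw [mul_assoc]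
  refine mul_le_mul_of_nonneg_left ?_ (Nat.cast_nonneg _)
  have h1 : ∑ t ∈ Finset.range T, disagreement x (t + 1) ≤ c₀ * M + c₁ * (K * M) := by
    have := mul_le_mul_of_nonneg_left hE hc₁
    have := mul_le_mul_of_nonneg_left hM hc₀
    linarith
  have h2 := mul_le_mul_of_nonneg_left h1 hF₂
  linarith

end IsPowerRun

end DistOCO

theorem mainTheorem2
    (n : ℕ) (hn : 0 < n) (κ : ℝ) (hκ0 : 0 < κ) (hκ1 : κ < 1)
    (F₁ F₂ R w : ℝ) (hw0 : 0 < w) (hw1 : w < 1) (B : ℕ) (hB : 0 < B) :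
    ∃ C₁ : ℝ, ∀ M : ℕ, ∃ C₂ : ℝ,
      ∀ (p : ℕ) (m : Fin n → ℕ), 0 < p → (∀ i, 0 < m i) → ∑ i, m i = M →
      ∀ (P : DistOCO.OnlineProblem n p m) (N : DistOCO.Network n)
        (x : Fin n → ℕ → DistOCO.Vec p) (q : (i : Fin n) → ℕ → DistOCO.Vec (m i)),
        P.Regular F₁ F₂ R →
        (∀ T : ℕ, 1 ≤ T → (P.staticFeasible T).Nonempty) →
        N.Regular w B →
        DistOCO.IsRun P N
          (fun t => 1 / (t : ℝ) ^ κ) (fun t => 1 / (t : ℝ) ^ κ)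
          (fun t => 1 / (t : ℝ) ^ (1 - κ)) x q →
        ∀ T : ℕ, 1 ≤ T →
          (∃ y, P.IsStaticOptimum T y) ∧
          (∀ y, P.IsStaticOptimum T y →
            P.netReg T x (fun _ => y) ≤ C₁ * (T : ℝ) ^ max κ (1 - κ)) ∧
          P.netViolation T x ≤ C₂ * (T : ℝ) ^ (1 - κ / 2) := by
  -- The constants are fixed before the problem is introduced, so their signs can be checked only
  -- later, once a regular problem gives R ≥ 0.
  obtain ⟨c₀, hc₀⟩ : ∃ c, c = 2 * R * (n * B) / w ^ (n * B) := ⟨_, rfl⟩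
  obtain ⟨c₁, hc₁⟩ : ∃ c, c = 2 * (n * B) / w ^ (n * B) := ⟨_, rfl⟩
  obtain ⟨K, hK⟩ : ∃ K, K = n * F₁ + n * (3 / 2 * (2 * R) ^ 2 + (F₁ + F₂ * (2 * R)) ^ 2 / κ)
      + 2 * F₂ * (n * c₀) + n / 2
      + n * (1 + (1 + 2 * F₂ * (1 + n * c₁)) ^ 2) / (2 * (1 - κ)) := ⟨_, rfl⟩
  refine ⟨3 / 2 * (2 * R) ^ 2 + (F₁ + F₂ * (2 * R)) ^ 2 / κ + 2 * F₂ * c₀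
        + (n * F₂ * c₁ + F₂ * (1 + n * c₁)) ^ 2 / (2 * (1 - κ)),
    fun M => ⟨M * (K + F₂ * (c₀ + c₁ * K)), ?_⟩⟩
  intro p m _ hm hM P N x q hP hfeas hN h T hT
  have hR := hP.R_nonneg
  have hc₀' : 0 ≤ c₀ := by rw [hc₀]; positivity
  have hc₁' : 0 ≤ c₁ := by rw [hc₁]; positivity
  have hD := DistOCO.IsPowerRun.sum_disagreement_le h hP hN hw0 hw1.le T
  rw [← hc₀, ← hc₁] at hD
  refine ⟨hP.exists_isStaticOptimum (hfeas T hT), fun y hy => ?_, ?_⟩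
  · exact DistOCO.IsPowerRun.netReg_le h hn hκ0 hκ1 hP hN hc₀' hT hD hy.1
  · subst hM
    refine DistOCO.IsPowerRun.netViolation_le_mul_rpow h hn hκ1 hP hc₀' hc₁' hT hD hm
      fun j k => ?_
    rw [hK]
    exact DistOCO.IsPowerRun.sum_pos_add_sum_perturbation_le h hκ0 hκ1 hP hN hc₀' hc₁' hT hD
      (hfeas T hT) j k
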